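/- **Setting.** For an integer $n$ write $[n]=\{1,\dots,n\}$, and $[j..k]=\{j,j+1,\dots,k\}$; $\log$ is to base $2$ and $\ln$ is natural. Let $\mathcal X_i,\mathcal Y_i,\mathcal U_i$ ($i\in[N]$) be finite sets. An *$N$-node acyclic discrete network* is a collection of conditional distributions (channels) $(P_{Y_i|X^{i-1},Y^{i-1}})_{i\in[N]}$, where $P_{Y_i|X^{i-1},Y^{i-1}}$ is a conditional distribution from $\prod_{j<i}\mathcal X_j\times\prod_{j<i}\mathcal Y_j$ to $\mathcal Y_i$. A *public-randomness coding scheme* consists of a probability distribution $P_W$ on some measurable space $\mathcal W$ and encoding functions $f_i:\mathcal Y_i\times\mathcal W\to\mathcal X_i$ ($i\in[N]$), measurable in $\mathcal W$. It operates as follows: draw $W\sim P_W$; then, for $i=1,\dots,N$ in turn, draw $\tilde Y_i$ according to $P_{Y_i|X^{i-1},Y^{i-1}}(\cdot\,|\,\tilde X^{i-1},\tilde Y^{i-1})$ (conditionally independent of $W$ given $\tilde X^{i-1},\tilde Y^{i-1}$) and set $\tilde X_i=f_i(\tilde Y_i,W)$. The joint law $P_{\tilde X^N,\tilde Y^N}$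 is the *actual distribution*. The total variation distance is $\delta_{\mathrm{TV}}(P,Q)=\sup_A|P(A)-Q(A)|$. For discrete random variables $A,B$ the information density is $\iota(A;B)=\log\frac{P_{A|B}(A|B)}{P_A(A)}$. **Theorem.** Fix an $N$-node acyclic discrete network. For each $i\in[N]$ let $d_i\ge 0$, let $a_{i,1},\dots,a_{i,d_i}$ be distinct indices in $[i-1]$, and let $0\le d'_i\le d_i$. For $\mathcal S\subseteq[d_i]$ put $\overline U_{i,\mathcal S}:=(U_{a_{i,j}})_{j\in\mathcal S}$, $\overline U_{i,k}:=U_{a_{i,k}}$ and $\overline U'_i:=\overline U_{i,[d'_i]}$. Fix any conditional distributions $P_{U_i|Y_i,\overline U'_i}$ and $P_{X_i|Y_i,U_i,\overline U'_i}$, $i\in[N]$, and let $(X^N,Y^N,U^N)$ have the induced joint distribution (the *ideal distribution*) $$\prod_{i=1}^N P_{Y_i|X^{i-1},Y^{i-1}}\,P_{U_i|Y_i,\overline U'_i}\,P_{X_i|Y_i,U_i,\overline U'_i}.$$ Then there exists a public-randomness coding scheme such that $$\delta_{\mathrm{TV}}\big(P_{X^N,Y^N},P_{\tilde X^N,\tilde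 Y^N}\big)\le \mathbf E\Big[\min\Big\{\sum_{i=1}^N\sum_{j=1}^{d'_i}B_{i,j},\,1\Big\}\Big],$$ where the expectation is over the ideal distribution, and for $i\in[N]$, $j\in[d'_i]$, $$B_{i,j}:=\gamma_{i,j}\prod_{k=j}^{d_i}\Big(2^{-\iota(\overline U_{i,k};\,\overline U_{i,[d_i]\setminus[j..k]},Y_i)+\iota(\overline U_{i,k};\,\overline U'_{a_{i,k}},Y_{a_{i,k}})}+\mathbf 1\{k>j\}\Big),\qquad \gamma_{i,j}:=\prod_{k=j+1}^{d_i}\big(\ln|\mathcal U_{a_{i,k}}|+1\big),$$ all information densities being computed under the ideal distribution. -/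

import Mathlib

open scoped ENNReal

noncomputable section

namespace OneShotADN

/-! ### Probability on finite sets -/

/-- The probability `P(E)` of an event, as a real number. -/
def prob {Ω : Type*} (P : PMF Ω) (E : Set Ω) : ℝ := (P.toOuterMeasure E).toReal

/-- The expectation of a real random variable on a finite probability space. -/
def expectation {Ω : Type*} [Fintype Ω] (P : PMF Ω) (F : Ω → ℝ) : ℝ :=
  ∑ ω, (P ω).toReal * F ω

/-- The total variation distance `sup_A |P(A) - Q(A)|`; on a finite (discrete) set every subset is
an event. -/
def tvDist {α : Type*} (P Q : PMF α) : ℝ := ⨆ A : Set α, |prob P A - prob Q A|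

/-- The information density (base 2) of the random variables `A` and `B` at the outcome `ω`:
`log₂ (P_{A|B}(A(ω) | B(ω)) / P_A(A(ω)))`. -/
def infoDensity {Ω α β : Type*} (P : PMF Ω) (A : Ω → α) (B : Ω → β) (ω : Ω) : ℝ :=
  Real.logb 2
    ((prob P {ω' | A ω' = A ω ∧ B ω' = B ω} / prob P {ω' | B ω' = B ω}) /
      prob P {ω' | A ω' = A ω})

/-! ### Sequential generation -/

lemma nonempty_of_kernels {N : ℕ} {A : Fin N → Type*}
    (K : ∀ i : Fin N, (∀ j : Set.Iio i, A j) → PMF (A i)) (i : Fin N) : Nonempty (A i) := by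
  induction i using WellFoundedLT.induction with
  | ind i ih =>
    have h : ∀ j : Set.Iio i, Nonempty (A j) := fun j => ih j j.2
    obtain ⟨x, _⟩ := (K i fun j => (h j).some).support_nonempty
    exact ⟨x⟩

lemma sum_prod_eq_one {N : ℕ} {A : Fin N → Type*} [∀ i, Fintype (A i)] [∀ i, Nonempty (A i)]
    (L : ∀ i : Fin N, (∀ j, A j) → A i → ℝ≥0∞)
    (hL : ∀ i t t', (∀ j, j < i → t j = t' j) → L i t = L i t')
    (h1 : ∀ i t, ∑ a, L i t a = 1) :
    ∑ t : ∀ i, A i, ∏ i, L i t (t i) = 1 := by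
  induction N with
  | zero => simp
  | succ n ih =>
    have t0 : ∀ j, A j := fun j => Classical.arbitrary _
    have hc : ∀ p, Fin.consEquiv A p = Fin.cons p.1 p.2 := fun _ => rfl
    rw [← (Fin.consEquiv A).sum_comp, Fintype.sum_prod_type]
    simp only [hc]
    have key : ∀ a : A 0, ∑ s : (∀ i : Fin n, A i.succ),
        ∏ i, L i (Fin.cons a s) ((Fin.cons a s : ∀ i, A i) i) = L 0 t0 a := by
      intro a
      have h0 : ∀ s : (∀ i : Fin n, A i.succ), L 0 (Fin.cons a s) = L 0 t0 :=
        fun s => hL 0 _ _ fun j hj => absurd hj (Fin.not_lt_zero j)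
      simp only [Fin.prod_univ_succ, Fin.cons_zero, Fin.cons_succ, h0]
      rw [← Finset.mul_sum, ih (fun i s => L i.succ (Fin.cons a s)), mul_one]
      · intro i t t' h
        refine hL _ _ _ fun j hj => ?_
        induction j using Fin.cases with
        | zero => simp
        | succ j => simpa using h j (by simpa using hj)
      · intro i t
        exact h1 _ _
    simp only [key, h1]

/-- The joint distribution of `T_1, …, T_N` generated one after the other, where `T_i` is drawn
from the conditional distribution `K i` given `T_1, …, T_{i-1}`; its mass function is the product
of the conditional mass functions. -/
def sequential {N : ℕ} {A : Fin N → Type*} [∀ i, Fintype (A i)]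
    (K : ∀ i : Fin N, (∀ j : Set.Iio i, A j) → PMF (A i)) : PMF (∀ i, A i) :=
  PMF.ofFintype (fun t => ∏ i, K i (fun j => t j) (t i)) <| by
    have := nonempty_of_kernels K
    refine sum_prod_eq_one (fun i t => K i (fun j => t j)) ?_ ?_
    · intro i t t' h
      have : (fun j : Set.Iio i => t j) = fun j : Set.Iio i => t' j := funext fun j => h j j.2
      simp only [this]
    · intro i t
      rw [← tsum_fintype (L := .unconditional _)]
      exact PMF.tsum_coe _

/-! ### Networks and coding schemes -/

/-- An `N`-node acyclic discrete network: the channels `P_{Y_i | X^{i-1}, Y^{i-1}}`. -/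
structure Network (N : ℕ) (X Y : Fin N → Type*) where
  channel : ∀ i : Fin N, (∀ j : Set.Iio i, X j) → (∀ j : Set.Iio i, Y j) → PMF (Y i)

/-- A public-randomness coding scheme: the law `P_W` of the public randomness on an arbitrary
probability space `W`, and the (measurable) encoding functions `f_i : Y_i × W → X_i`. -/
structure PublicScheme {N : ℕ} (X Y : Fin N → Type*) where
  W : Type
  [mW : MeasurableSpace W]
  PW : MeasureTheory.Measure W
  [isProb : MeasureTheory.IsProbabilityMeasure PW]
  f : ∀ i : Fin N, Y i → W → X i
  measurable_f : ∀ (i : Fin N) (y : Y i), @Measurable W (X i) mW ⊤ (f i y)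

attribute [instance] PublicScheme.mW PublicScheme.isProb

variable {N : ℕ} {X Y U : Fin N → Type*}

/-- The operation of the network at node `i` when the public randomness takes the value `w`:
`Y_i` is drawn from the channel given the past inputs and outputs, and `X_i = f_i(Y_i, w)`. -/
def PublicScheme.step (S : PublicScheme X Y) (net : Network N X Y) (w : S.W) (i : Fin N)
    (past : ∀ j : Set.Iio i, X j × Y j) : PMF (X i × Y i) :=
  (net.channel i (fun j => (past j).1) (fun j => (past j).2)).map fun y => (S.f i y w, y)

lemma PublicScheme.measurable_step (S : PublicScheme X Y) [∀ i, Fintype (Y i)]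
    (net : Network N X Y) (i : Fin N) (past : ∀ j : Set.Iio i, X j × Y j) (xy : X i × Y i) :
    Measurable fun w => S.step net w i past xy := by
  classical
  simp only [PublicScheme.step, PMF.map_apply, tsum_fintype]
  refine Finset.measurable_sum _ fun y _ => ?_
  refine Measurable.ite ?_ measurable_const measurable_const
  by_cases hy : xy.2 = y
  · have : {w | xy = (S.f i y w, y)} = S.f i y ⁻¹' {xy.1} := by
      ext w
      simp [Prod.ext_iff, hy, eq_comm]
    rw [this]
    exact S.measurable_f i y trivial
  · have : {w | xy = (S.f i y w, y)} = ∅ := by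
      ext w
      simp [Prod.ext_iff, hy]
    rw [this]
    exact MeasurableSet.empty

/-- The actual joint distribution of the inputs and outputs `(X_i, Y_i)_i` induced by the scheme:
`W` is drawn from `P_W`, and then the nodes operate one after the other. -/
def PublicScheme.actual (S : PublicScheme X Y) [∀ i, Fintype (X i)] [∀ i, Fintype (Y i)]
    (net : Network N X Y) : PMF (∀ i, X i × Y i) :=
  PMF.ofFintype (fun xy => ∫⁻ w, sequential (S.step net w) xy ∂S.PW) <| by
    rw [← MeasureTheory.lintegral_finsetSum]
    · have h : ∀ w, ∑ xy, sequential (A := fun i => X i × Y i) (S.step net w) xy = 1 := fun w => by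
        rw [← tsum_fintype (L := .unconditional _)]
        exact PMF.tsum_coe _
      simp [h]
    · intro xy _
      simp only [sequential, PMF.ofFintype_apply]
      exact Finset.measurable_prod _ fun i _ => S.measurable_step net i _ _

/-! ### Decoding orders and the ideal distribution -/

/-- The decoding orders: node `i` uses the auxiliaries with the distinct indices
`a i 0, …, a i (d i - 1) < i`, of which the first `d' i` are decoded uniquely. -/
structure DecodingOrder (N : ℕ) where
  d : Fin N → ℕ
  a : ∀ i : Fin N, Fin (d i) → Fin N
  a_lt : ∀ i j, a i j < i
  a_injective : ∀ i, Function.Injective (a i)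
  d' : Fin N → ℕ
  d'_le : ∀ i, d' i ≤ d i

/-- The positions in the decoding order of node `i` that are decoded uniquely. -/
def DecodingOrder.uniq (o : DecodingOrder N) (i : Fin N) : Finset (Fin (o.d i)) :=
  Finset.univ.filter fun j => j.val < o.d' i

/-- The alphabet of the tuple `(U_{a_{i,j}})_{j ∈ S}`. -/
abbrev DecodingOrder.Tuple (o : DecodingOrder N) (U : Fin N → Type*) (i : Fin N)
    (S : Finset (Fin (o.d i))) : Type _ := ∀ j : S, U (o.a i j)

/-- The conditional distributions `P_{U_i | Y_i, U'_i}` and `P_{X_i | Y_i, U_i, U'_i}`, where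
`U'_i` is the tuple of the auxiliaries decoded uniquely by node `i`. -/
structure NodeLaws (o : DecodingOrder N) (X Y U : Fin N → Type*) where
  PU : ∀ i : Fin N, Y i → o.Tuple U i (o.uniq i) → PMF (U i)
  PX : ∀ i : Fin N, Y i → U i → o.Tuple U i (o.uniq i) → PMF (X i)

/-- One step of the ideal network: `Y_i` is drawn from the channel, `U_i` from `P_{U_i|Y_i,U'_i}`,
and `X_i` from `P_{X_i|Y_i,U_i,U'_i}`. -/
def idealStep (net : Network N X Y) {o : DecodingOrder N} (laws : NodeLaws o X Y U) (i : Fin N)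
    (past : ∀ j : Set.Iio i, X j × Y j × U j) : PMF (X i × Y i × U i) :=
  let u' : o.Tuple U i (o.uniq i) := fun j => (past ⟨o.a i j, o.a_lt i j⟩).2.2
  (net.channel i (fun j => (past j).1) (fun j => (past j).2.1)).bind fun y =>
    (laws.PU i y u').bind fun u =>
      (laws.PX i y u u').map fun x => (x, y, u)

/-- The random variable `Y_i`. -/
def rvY (i : Fin N) (ω : ∀ i, X i × Y i × U i) : Y i := (ω i).2.1

/-- The random variable `U_i`. -/
def rvU (i : Fin N) (ω : ∀ i, X i × Y i × U i) : U i := (ω i).2.2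

/-- The random tuple `(U_{a_{i,j}})_{j ∈ S}`. -/
def rvTuple (o : DecodingOrder N) (i : Fin N) (S : Finset (Fin (o.d i)))
    (ω : ∀ i, X i × Y i × U i) : o.Tuple U i S := fun j => rvU (o.a i j) ω

/-- The factor `γ_{i,j} = ∏_{k > j} (ln |U_{a_{i,k}}| + 1)`. -/
def gammaFactor (U : Fin N → Type*) [∀ i, Fintype (U i)] (o : DecodingOrder N) (i : Fin N)
    (j : Fin (o.d i)) : ℝ :=
  ∏ k ∈ Finset.Ioi j, (Real.log (Fintype.card (U (o.a i k))) + 1)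

section

variable [∀ i, Fintype (X i)] [∀ i, Fintype (Y i)] [∀ i, Fintype (U i)]

/-- The ideal joint distribution of `(X_i, Y_i, U_i)_i`. -/
def ideal (net : Network N X Y) {o : DecodingOrder N} (laws : NodeLaws o X Y U) :
    PMF (∀ i, X i × Y i × U i) :=
  sequential (idealStep net laws)

/-- The ideal joint distribution of the inputs and outputs `(X_i, Y_i)_i`. -/
def idealXY (net : Network N X Y) {o : DecodingOrder N} (laws : NodeLaws o X Y U) :
    PMF (∀ i, X i × Y i) :=
  (ideal net laws).map fun ω i => ((ω i).1, (ω i).2.1)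

/-- The random variable `B_{i,j}`, a function of the outcome `ω` of the ideal network. -/
def boundTerm (net : Network N X Y) {o : DecodingOrder N} (laws : NodeLaws o X Y U) (i : Fin N)
    (j : Fin (o.d i)) (ω : ∀ i, X i × Y i × U i) : ℝ :=
  gammaFactor U o i j *
    ∏ k ∈ Finset.Ici j,
      ((2 : ℝ) ^
          (-infoDensity (ideal net laws) (rvU (o.a i k))
              (fun ω' => (rvTuple o i (Finset.univ \ Finset.Icc j k) ω', rvY i ω')) ω
            + infoDensity (ideal net laws) (rvU (o.a i k))
              (fun ω' => (rvTuple o (o.a i k) (o.uniq (o.a i k)) ω', rvY (o.a i k) ω')) ω)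
        + if j < k then 1 else 0)

end

end OneShotADN

end

/-! Apart from the channels, all randomness comes from exponential races: attach independent
rate-one clocks z to the letters of an alphabet and pick the letter minimising z_u / p_u. The winner
has law p, and a race on the same clocks with other rates q has the same winner u except with
conditional probability at most p_u / q_u (`pi_stdExp_wins_and_not_wins`). Each node selects U_m and
X_m by such races on its own public clocks; a later node recovers U_m by racing the same clocks with
rates of its own.

To decode position j, node i works from its last position down to j + 1. At position k the
candidates are sorted by their performance in the race with the conditional law given y, the
positions before j and those after k, and receive weight 1/rank, normalised by ln|U| + 1, which
dominates the harmonic sum. Multiplying by the conditional law of position j given all others and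
summing over tuples gives subprobability rates (`sum_decodingRate_le_one`). Keeping only the true
tuple in this sum bounds the error by p/q at position j times γ and the ranks of the true values,
and the mean rank of a winner is at most p/q + 1 (`lintegral_wins_rank`). Clocks of distinct nodes
are independent, so the means multiply; since p/q is 2 to the difference of information densities,
the result is B_{i,j} (`pi_followLaw_not_decodes`).

No coupling of two processes is needed: an ideal outcome ω is fixed instead. The clocks for which
every node, fed with the values of ω, selects the values of ω form a product set, whose probability
times the channel probability is exactly the ideal mass of ω. Hence independence survives the
conditioning. On the part without decoding errors the scheme reproduces the inputs of ω, so this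
part is mass common to the actual and ideal laws. A union bound over (i, j), capped at 1, controls
the missing mass (`commonMass_le_actual`, `ideal_le_add`, `tvDist_le_of_common_mass`). -/

noncomputable section

namespace OneShotADN

section

open MeasureTheory Set

/-! ### The standard exponential distribution -/

/-- The exponential distribution with rate `1`. -/
def stdExp : Measure ℝ :=
  (volume.restrict (Ioi 0)).withDensity fun x => ENNReal.ofReal (Real.exp (-x))

lemma lintegral_stdExp {f : ℝ → ℝ≥0∞} (hf : Measurable f) :
    ∫⁻ x, f x ∂stdExp = ∫⁻ x in Ioi (0 : ℝ), ENNReal.ofReal (Real.exp (-x)) * f x := by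
  rw [stdExp, lintegral_withDensity_eq_lintegral_mul _ (by fun_prop) hf]
  rfl

lemma stdExp_Ioi {t : ℝ} (ht : 0 ≤ t) : stdExp (Ioi t) = ENNReal.ofReal (Real.exp (-t)) := by
  rw [stdExp, withDensity_apply _ measurableSet_Ioi, Measure.restrict_restrict measurableSet_Ioi,
    Ioi_inter_Ioi, max_eq_left ht, ← integral_exp_neg_Ioi t,
    ofReal_integral_eq_lintegral_ofReal (integrableOn_exp_neg_Ioi t)
      (Filter.Eventually.of_forall fun x => (Real.exp_pos _).le)]

lemma ae_stdExp_pos : ∀ᵐ x ∂stdExp, 0 < x := by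
  refine (withDensity_absolutelyContinuous _ _).ae_le ?_
  exact ae_restrict_mem measurableSet_Ioi

instance : IsProbabilityMeasure stdExp := by
  constructor
  have h : stdExp univ = stdExp (Ioi 0) :=
    measure_congr (Filter.eventuallyEq_set.2 (by
      filter_upwards [ae_stdExp_pos] with x hx
      simpa using hx))
  rw [h, stdExp_Ioi le_rfl]
  simp

/-- From e^{-s} - e^{-t} = e^{-s}(1 - e^{-(t-s)}) ≤ e^{-s}(t - s), after which -s is discarded. The
factor e^{-s} must be kept: it completes the product over all competitors in the race. -/
lemma stdExp_Ioc_le {s t : ℝ} (hs : 0 ≤ s) (ht : 0 ≤ t) :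
    stdExp (Ioc s t) ≤ ENNReal.ofReal (Real.exp (-s) * t) := by
  rcases le_or_gt t s with h | h
  · simp [Ioc_eq_empty_of_le h]
  · have h1 : Ioc s t = Ioi s \ Ioi t := by ext; simp
    rw [h1, measure_sdiff (Ioi_subset_Ioi h.le) measurableSet_Ioi.nullMeasurableSet
      (measure_ne_top _ _), stdExp_Ioi hs, stdExp_Ioi ht,
      ← ENNReal.ofReal_sub _ (Real.exp_pos _).le]
    refine ENNReal.ofReal_le_ofReal ?_
    have h2 : Real.exp (-t) = Real.exp (-s) * Real.exp (-(t - s)) := by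
      rw [← Real.exp_add]; ring_nf
    have h3 := Real.add_one_le_exp (-(t - s))
    have h4 := Real.exp_pos (-s)
    rw [h2]
    nlinarith

lemma lintegral_exp_neg_mul {c : ℝ} (hc : 0 < c) :
    ∫⁻ x in Ioi (0 : ℝ), ENNReal.ofReal (Real.exp (-(c * x))) = ENNReal.ofReal (1 / c) := by
  have h := Real.integral_rpow_mul_exp_neg_mul_Ioi one_pos hc
  simp only [sub_self, Real.rpow_zero, one_mul, Real.rpow_one, Real.Gamma_one, mul_one] at h
  rw [← h, ofReal_integral_eq_lintegral_ofReal (.of_integral_ne_zero (by rw [h]; positivity))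
      (Filter.Eventually.of_forall fun x => (Real.exp_pos _).le)]

lemma lintegral_mul_exp_neg_mul {c : ℝ} (hc : 0 < c) :
    ∫⁻ x in Ioi (0 : ℝ), ENNReal.ofReal (x * Real.exp (-(c * x))) =
      ENNReal.ofReal ((1 / c) ^ 2) := by
  have h := Real.integral_rpow_mul_exp_neg_mul_Ioi two_pos hc
  have h2 : (2 : ℝ) - 1 = 1 := by norm_num
  simp only [h2, Real.rpow_one, Real.Gamma_two, mul_one, Real.rpow_two] at h
  rw [← h, ofReal_integral_eq_lintegral_ofReal (.of_integral_ne_zero (by rw [h]; positivity))]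
  filter_upwards [ae_restrict_mem measurableSet_Ioi] with x hx
  exact mul_nonneg (le_of_lt hx) (Real.exp_pos _).le

/-! ### Exponential races -/

/-- The element `u` wins the race with rates `p` and clocks `z`: the quotient `z u / p u` is
strictly smaller than all the others. -/
def Wins {ι : Type*} (p z : ι → ℝ) (u : ι) : Prop := ∀ v, v ≠ u → p v * z u < p u * z v

/-- The rank of `u` when the elements are sorted in ascending order of `z v / q v`. -/
def rank {ι : Type*} [Fintype ι] (q z : ι → ℝ) (u : ι) : ℕ :=
  open Classical in (Finset.univ.filter fun v => q u / z u ≤ q v / z v).card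

lemma Wins.unique {ι : Type*} {p z : ι → ℝ} {u v : ι} (hu : Wins p z u) (hv : Wins p z v) :
    u = v := by
  by_contra h
  have h1 := hu v (Ne.symm h)
  have h2 := hv u h
  exact lt_asymm h1 h2

lemma Wins.comp_equiv {ι κ : Type*} (e : ι ≃ κ) (p : ι → ℝ) (z : κ → ℝ) (u : ι) :
    Wins p (z ∘ e) u ↔ Wins (p ∘ e.symm) z (e u) := by
  constructor
  · intro h v hv
    simpa using h (e.symm v) (by rintro rfl; simp at hv)
  · intro h v hv
    simpa using h (e v) (by simpa using hv)

lemma rank_pos {ι : Type*} [Fintype ι] (q z : ι → ℝ) (u : ι) : 0 < rank q z u := by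
  classical
  rw [rank, Finset.card_pos]
  exact ⟨u, by simp⟩

/-- The reciprocals of the ranks of the elements sum to at most the harmonic number. -/
lemma sum_inv_rank_le {ι : Type*} [Fintype ι] (q z : ι → ℝ) :
    ∑ u, ((rank q z u : ℝ))⁻¹ ≤ Real.log (Fintype.card ι) + 1 := by
  classical
  have key : ∀ s : Finset ι,
      ∑ u ∈ s, (((s.filter fun v => q u / z u ≤ q v / z v).card : ℝ))⁻¹ ≤
        ((harmonic s.card : ℚ) : ℝ) := by
    intro s
    -- The inserted element has the smallest quotient, so its rank in the enlarged set is the full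
    -- cardinality; the other ranks can only grow.
    induction s using Finset.induction_on_min_value (fun u => q u / z u) with
    | empty => simp
    | insert a s ha hmin ih =>
      rw [Finset.sum_insert ha, Finset.card_insert_of_notMem ha, harmonic_succ]
      have h1 : ((insert a s).filter fun v => q a / z a ≤ q v / z v) = insert a s := by
        refine Finset.filter_true_of_mem fun v hv => ?_
        rcases Finset.mem_insert.1 hv with rfl | hv
        · exact le_rfl
        · exact hmin v hv
      rw [h1, Finset.card_insert_of_notMem ha]
      push_cast
      rw [add_comm]
      refine add_le_add (le_trans ?_ ih) le_rfl
      refine Finset.sum_le_sum fun u hu => ?_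
      refine inv_anti₀ ?_ ?_
      · rw [Nat.cast_pos, Finset.card_pos]
        exact ⟨u, by simp [hu]⟩
      · exact_mod_cast Finset.card_le_card
          (Finset.filter_subset_filter _ (Finset.subset_insert a s))
  refine (key Finset.univ).trans ?_
  rw [Finset.card_univ, add_comm]
  exact harmonic_le_one_add_log _

/-- Fubini after singling out the clock of u: given its value x, the constraints on the other clocks
are independent. -/
lemma pi_stdExp_section {n : ℕ} (u : Fin (n + 1)) (S : Fin (n + 1) → ℝ → Set ℝ)
    (hS : ∀ v, MeasurableSet {p : ℝ × ℝ | p.2 ∈ S v p.1}) :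
    Measure.pi (fun _ : Fin (n + 1) => stdExp) {z | ∀ v, v ≠ u → z v ∈ S v (z u)} =
      ∫⁻ x, ∏ v ∈ Finset.univ.erase u, stdExp (S v x) ∂stdExp := by
  have hm := measurePreserving_piFinSuccAbove (fun _ : Fin (n + 1) => stdExp) u
  set T : Set (ℝ × (Fin n → ℝ)) := {p | ∀ j, p.2 j ∈ S (u.succAbove j) p.1}
  have hT : MeasurableSet T := by
    have : T = ⋂ j, (fun p : ℝ × (Fin n → ℝ) => (p.1, p.2 j)) ⁻¹'
        {p : ℝ × ℝ | p.2 ∈ S (u.succAbove j) p.1} := by ext; simp [T]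
    rw [this]
    exact MeasurableSet.iInter fun j => (by fun_prop : Measurable _) (hS _)
  have hpre : {z : Fin (n + 1) → ℝ | ∀ v, v ≠ u → z v ∈ S v (z u)} =
      MeasurableEquiv.piFinSuccAbove (fun _ => ℝ) u ⁻¹' T := by
    ext z
    simp only [mem_ofPred_eq, mem_preimage, T, MeasurableEquiv.piFinSuccAbove]
    constructor
    · intro h j
      exact h _ (Fin.succAbove_ne _ _)
    · intro h v hv
      obtain ⟨j, rfl⟩ := Fin.exists_succAbove_eq hv
      exact h j
  rw [hpre, hm.measure_preimage hT.nullMeasurableSet, Measure.prod_apply hT]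
  refine lintegral_congr fun x => ?_
  have h1 : Prod.mk x ⁻¹' T = Set.pi univ fun j => S (u.succAbove j) x := by
    ext; simp [T]
  rw [h1, Measure.pi_pi]
  have h2 : (Finset.univ.erase u) = Finset.univ.map u.succAboveEmb := by
    ext v
    simp [Fin.exists_succAbove_eq_iff]
  rw [h2, Finset.prod_map]
  rfl

lemma measurableSet_setOf_and {α : Type*} [MeasurableSpace α] {P Q : α → Prop}
    (hP : MeasurableSet {x | P x}) (hQ : MeasurableSet {x | Q x}) :
    MeasurableSet {x | P x ∧ Q x} :=
  hP.inter hQ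

lemma measurableSet_wins {ι : Type*} [Fintype ι] (p : ι → ℝ) (u : ι) :
    MeasurableSet {z : ι → ℝ | Wins p z u} := by
  have : {z : ι → ℝ | Wins p z u} =
      ⋂ v, ⋂ (_ : v ≠ u), {z : ι → ℝ | p v * z u < p u * z v} := by
    ext; simp [Wins]
  rw [this]
  exact MeasurableSet.iInter fun v => MeasurableSet.iInter fun _ =>
    measurableSet_lt (by fun_prop) (by fun_prop)

lemma ae_pi_stdExp_pos {n : ℕ} : ∀ᵐ z ∂Measure.pi fun _ : Fin n => stdExp, ∀ v, 0 < z v := by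
  rw [ae_all_iff]
  intro v
  exact (Measure.tendsto_eval_ae_ae (μ := fun _ : Fin n => stdExp) (i := v)).eventually
    ae_stdExp_pos

/-- As the rates sum to one, the exponents add up to x + (1 - p u) x / p u = x / p u. -/
lemma prod_exp_neg {n : ℕ} {p : Fin (n + 1) → ℝ} (h1 : ∑ v, p v = 1)
    {u : Fin (n + 1)} (hu : 0 < p u) (x : ℝ) :
    Real.exp (-x) * ∏ v ∈ Finset.univ.erase u, Real.exp (-(p v * x / p u)) =
      Real.exp (-(1 / p u * x)) := by
  rw [← Real.exp_sum, ← Real.exp_add]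
  congr 1
  have h2 : ∑ v ∈ Finset.univ.erase u, -(p v * x / p u) =
      -((∑ v ∈ Finset.univ.erase u, p v) * (x / p u)) := by
    rw [Finset.sum_mul, ← Finset.sum_neg_distrib]
    exact Finset.sum_congr rfl fun v _ => by ring
  rw [h2, Finset.sum_erase_eq_sub (Finset.mem_univ u), h1]
  field_simp
  ring

lemma not_wins_of_eq_zero {n : ℕ} {p z : Fin n → ℝ} (hp : ∀ v, 0 ≤ p v) (h1 : ∑ v, p v = 1)
    {u : Fin n} (hu : p u = 0) (hz : ∀ v, 0 < z v) : ¬ Wins p z u := by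
  intro h
  have hex : ∃ v, p v ≠ 0 := by
    by_contra! hc
    simp [hc] at h1
  obtain ⟨v, hv⟩ := hex
  have h2 := h v (by rintro rfl; exact hv hu)
  rw [hu, zero_mul] at h2
  exact absurd h2 (not_lt.2 (mul_nonneg (hp v) (hz u).le))

/-- The winner of the race with rates `p` has the law `p`. -/
lemma pi_stdExp_wins {n : ℕ} {p : Fin n → ℝ} (hp : ∀ v, 0 ≤ p v) (h1 : ∑ v, p v = 1)
    (u : Fin n) :
    Measure.pi (fun _ : Fin n => stdExp) {z | Wins p z u} = ENNReal.ofReal (p u) := by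
  rcases n with _ | n
  · exact u.elim0
  rcases (hp u).eq_or_lt with hu | hu
  · rw [← hu, ENNReal.ofReal_zero, measure_eq_zero_iff_ae_notMem]
    filter_upwards [ae_pi_stdExp_pos] with z hz
    exact not_wins_of_eq_zero hp h1 hu.symm hz
  have hset : {z : Fin (n + 1) → ℝ | Wins p z u} =
      {z | ∀ v, v ≠ u → z v ∈ Ioi (p v * z u / p u)} := by
    ext z
    simp only [Wins, mem_ofPred_eq, mem_Ioi, div_lt_iff₀ hu, mul_comm (p u)]
  rw [hset, pi_stdExp_section u (fun v x => Ioi (p v * x / p u))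
    fun v => by simpa only [mem_Ioi] using measurableSet_lt (by fun_prop) (by fun_prop)]
  have hmeas : Measurable fun x => ∏ v ∈ Finset.univ.erase u,
      ENNReal.ofReal (Real.exp (-(p v * x / p u))) := by fun_prop
  calc _ = ∫⁻ x, ∏ v ∈ Finset.univ.erase u,
        ENNReal.ofReal (Real.exp (-(p v * x / p u))) ∂stdExp := by
        refine lintegral_congr_ae ?_
        filter_upwards [ae_stdExp_pos] with x hx
        exact Finset.prod_congr rfl fun v _ => stdExp_Ioi (by have := hp v; positivity)
    _ = ∫⁻ x in Ioi (0 : ℝ), ENNReal.ofReal (Real.exp (-(1 / p u * x))) := by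
        rw [lintegral_stdExp hmeas]
        refine lintegral_congr fun x => ?_
        rw [← ENNReal.ofReal_prod_of_nonneg fun v _ => (Real.exp_pos _).le,
          ← ENNReal.ofReal_mul (Real.exp_pos _).le, prod_exp_neg h1 hu]
    _ = _ := by
        rw [lintegral_exp_neg_mul (by positivity)]
        simp

/-- If `u` wins the race with rates `p`, then it is unlikely that `v` beats `u` in the race with
rates `q` unless `q v` is large. -/
lemma pi_stdExp_wins_and_le {n : ℕ} {p q : Fin n → ℝ} (hp : ∀ v, 0 ≤ p v) (h1 : ∑ v, p v = 1)
    (hq : ∀ v, 0 ≤ q v) {u v : Fin n} (hqu : 0 < q u) (hvu : v ≠ u) :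
    Measure.pi (fun _ : Fin n => stdExp) {z | Wins p z u ∧ q u * z v ≤ q v * z u} ≤
      ENNReal.ofReal (p u * (p u * q v / q u)) := by
  rcases n with _ | n
  · exact u.elim0
  rcases (hp u).eq_or_lt with hu | hu
  · refine (le_of_eq ?_).trans zero_le
    rw [measure_eq_zero_iff_ae_notMem]
    filter_upwards [ae_pi_stdExp_pos] with z hz h
    exact not_wins_of_eq_zero hp h1 hu.symm hz h.1
  -- Losing the p-race bounds the clock of v from below, beating u in the q-race bounds it from
  -- above; every other clock keeps only its lower bound.
  have hset : {z : Fin (n + 1) → ℝ | Wins p z u ∧ q u * z v ≤ q v * z u} ⊆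
      {z | ∀ w, w ≠ u → z w ∈ if w = v then Ioc (p w * z u / p u) (q v * z u / q u)
        else Ioi (p w * z u / p u)} := by
    rintro z ⟨hz, hz'⟩ w hw
    have h2 := hz w hw
    split_ifs with hwv
    · subst hwv
      refine ⟨by rw [div_lt_iff₀ hu]; linarith, by rw [le_div_iff₀ hqu]; linarith⟩
    · rw [mem_Ioi, div_lt_iff₀ hu]
      linarith
  refine (measure_mono hset).trans ?_
  rw [pi_stdExp_section u (fun w x => if w = v then Ioc (p w * x / p u) (q v * x / q u)
        else Ioi (p w * x / p u))]
  swap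
  · intro w
    by_cases hwv : w = v
    · simp only [hwv, if_true, mem_Ioc]
      exact measurableSet_setOf_and (measurableSet_lt (by fun_prop) (by fun_prop))
        (measurableSet_le (by fun_prop) (by fun_prop))
    · simp only [hwv, if_false, mem_Ioi]
      exact measurableSet_lt (by fun_prop) (by fun_prop)
  have hmeas : Measurable fun x => ENNReal.ofReal (q v * x / q u) *
      ∏ w ∈ Finset.univ.erase u, ENNReal.ofReal (Real.exp (-(p w * x / p u))) := by fun_prop
  have hv : v ∈ Finset.univ.erase u := by simp [hvu]
  calc _ ≤ ∫⁻ x, ENNReal.ofReal (q v * x / q u) * ∏ w ∈ Finset.univ.erase u,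
        ENNReal.ofReal (Real.exp (-(p w * x / p u))) ∂stdExp := by
        refine lintegral_mono_ae ?_
        filter_upwards [ae_stdExp_pos] with x hx
        rw [← Finset.mul_prod_erase _ _ hv, ← Finset.mul_prod_erase _ _ hv, ← mul_assoc]
        have hpx : ∀ w, 0 ≤ p w * x / p u := fun w => by have := hp w; positivity
        refine mul_le_mul' ?_ (Finset.prod_le_prod' fun w hw => ?_)
        · rw [if_pos rfl, ← ENNReal.ofReal_mul (by have := hq v; positivity),
            mul_comm (q v * x / q u)]
          exact stdExp_Ioc_le (hpx v) (by have := hq v; positivity)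
        · rw [if_neg (Finset.ne_of_mem_erase hw), stdExp_Ioi (hpx w)]
    -- What remains is (q v / q u) times the integral of x e^{-x / p u}, whose value is (p u)^2.
    _ = ∫⁻ x in Ioi (0 : ℝ), ENNReal.ofReal (q v / q u) *
          ENNReal.ofReal (x * Real.exp (-(1 / p u * x))) := by
        rw [lintegral_stdExp hmeas]
        refine lintegral_congr fun x => ?_
        rw [← ENNReal.ofReal_prod_of_nonneg fun v _ => (Real.exp_pos _).le, mul_left_comm,
          ← ENNReal.ofReal_mul (Real.exp_pos _).le, prod_exp_neg h1 hu,
          ← ENNReal.ofReal_mul' (Real.exp_pos _).le, ← ENNReal.ofReal_mul (by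
            have := hq v; positivity)]
        congr 1
        ring
    _ ≤ _ := by
        rw [lintegral_const_mul _ (by fun_prop), lintegral_mul_exp_neg_mul (by positivity),
          ← ENNReal.ofReal_mul (by have := hq v; positivity)]
        refine ENNReal.ofReal_le_ofReal (le_of_eq ?_)
        field_simp

/-- The common source of two bounds: as a union bound it controls the event that u loses the q-race,
as an expected count it controls the rank of u. -/
lemma sum_pi_stdExp_wins_and_le {n : ℕ} {p q : Fin n → ℝ} (hp : ∀ v, 0 ≤ p v)
    (h1 : ∑ v, p v = 1) (hq : ∀ v, 0 ≤ q v) (hq1 : ∑ v, q v ≤ 1) {u : Fin n} (hqu : 0 < q u) :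
    ∑ v ∈ Finset.univ.erase u,
      Measure.pi (fun _ : Fin n => stdExp) {z | Wins p z u ∧ q u * z v ≤ q v * z u} ≤
      ENNReal.ofReal (p u) * ENNReal.ofReal (p u / q u) := by
  have hpu := hp u
  calc _ ≤ ∑ v ∈ Finset.univ.erase u, ENNReal.ofReal (p u * (p u * q v / q u)) :=
        Finset.sum_le_sum fun v hv =>
          pi_stdExp_wins_and_le hp h1 hq hqu (Finset.ne_of_mem_erase hv)
    _ = ENNReal.ofReal (∑ v ∈ Finset.univ.erase u, p u * (p u * q v / q u)) := by
        rw [ENNReal.ofReal_sum_of_nonneg]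
        intro v _
        have := hq v
        positivity
    _ ≤ _ := by
        rw [← ENNReal.ofReal_mul hpu]
        refine ENNReal.ofReal_le_ofReal ?_
        have h2 : ∀ v, p u * (p u * q v / q u) = p u * (p u / q u) * q v := fun v => by ring
        simp only [h2]
        rw [← Finset.mul_sum]
        refine mul_le_of_le_one_right (by positivity) (le_trans ?_ hq1)
        exact Finset.sum_le_univ_sum_of_nonneg hq

/-- The winner of the race with rates `p` differs from the winner of the race with rates `q` with
small conditional probability. -/
lemma pi_stdExp_wins_and_not_wins {n : ℕ} {p q : Fin n → ℝ} (hp : ∀ v, 0 ≤ p v)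
    (h1 : ∑ v, p v = 1) (hq : ∀ v, 0 ≤ q v) (hq1 : ∑ v, q v ≤ 1) {u : Fin n} (hqu : 0 < q u) :
    Measure.pi (fun _ : Fin n => stdExp) {z | Wins p z u ∧ ¬ Wins q z u} ≤
      ENNReal.ofReal (p u) * ENNReal.ofReal (p u / q u) := by
  refine le_trans ?_ (sum_pi_stdExp_wins_and_le hp h1 hq hq1 hqu)
  refine le_trans (measure_mono ?_) (measure_biUnion_finset_le _ _)
  rintro z ⟨hz, hz'⟩
  simp only [Wins, not_forall, not_lt] at hz'
  obtain ⟨v, hv, hv'⟩ := hz'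
  simp only [mem_iUnion]
  exact ⟨v, by simp [hv], hz, hv'⟩

/-- The expected rank for the rates `q` of the winner of the race with rates `p`. -/
lemma lintegral_wins_rank {n : ℕ} {p q : Fin n → ℝ} (hp : ∀ v, 0 ≤ p v)
    (h1 : ∑ v, p v = 1) (hq : ∀ v, 0 ≤ q v) (hq1 : ∑ v, q v ≤ 1) {u : Fin n} (hqu : 0 < q u) :
    ∫⁻ z, {z | Wins p z u}.indicator (fun z => (rank q z u : ℝ≥0∞)) z
        ∂Measure.pi (fun _ : Fin n => stdExp) ≤
      ENNReal.ofReal (p u) * ENNReal.ofReal (p u / q u + 1) := by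
  classical
  have hm : ∀ v, MeasurableSet {z : Fin n → ℝ | Wins p z u ∧ q u * z v ≤ q v * z u} := fun v =>
    measurableSet_setOf_and (measurableSet_wins p u) (measurableSet_le (by fun_prop) (by fun_prop))
  calc _ ≤ ∫⁻ z, ({z | Wins p z u}.indicator 1 z + ∑ v ∈ Finset.univ.erase u,
          {z | Wins p z u ∧ q u * z v ≤ q v * z u}.indicator 1 z)
          ∂Measure.pi (fun _ : Fin n => stdExp) := by
        refine lintegral_mono_ae ?_
        filter_upwards [ae_pi_stdExp_pos] with z hz
        by_cases hw : Wins p z u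
        · have hr : rank q z u ≤ 1 + ((Finset.univ.erase u).filter
              fun v => q u * z v ≤ q v * z u).card := by
            rw [rank, add_comm, ← Finset.card_insert_of_notMem (a := u) (by simp)]
            refine Finset.card_le_card fun v hv => ?_
            simp only [Finset.mem_filter, Finset.mem_univ, true_and] at hv
            rw [div_le_div_iff₀ (hz u) (hz v)] at hv
            by_cases hvu : v = u <;> simp [hvu, hv]
          simp only [indicator, mem_ofPred_eq, hw, if_true, true_and, Pi.one_apply]
          rw [Finset.sum_boole]
          exact_mod_cast hr
        · simp [indicator, hw]
    _ = Measure.pi (fun _ : Fin n => stdExp) {z | Wins p z u} + ∑ v ∈ Finset.univ.erase u,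
          Measure.pi (fun _ : Fin n => stdExp) {z | Wins p z u ∧ q u * z v ≤ q v * z u} := by
        rw [lintegral_add_left (measurable_one.indicator (measurableSet_wins p u)),
          lintegral_finsetSum _ fun v _ => measurable_one.indicator (hm v)]
        simp only [lintegral_indicator_one (hm _), lintegral_indicator_one (measurableSet_wins p u)]
    _ ≤ ENNReal.ofReal (p u) + ENNReal.ofReal (p u) * ENNReal.ofReal (p u / q u) :=
        add_le_add (pi_stdExp_wins hp h1 u).le (sum_pi_stdExp_wins_and_le hp h1 hq hq1 hqu)
    _ = _ := by
        have := hp u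
        rw [ENNReal.ofReal_add (by positivity) one_pos.le, ENNReal.ofReal_one, mul_add, mul_one,
          add_comm]

end

/-! ### Probabilities on finite spaces -/

lemma prob_eq_sum {Ω : Type*} [Fintype Ω] (P : PMF Ω) (E : Set Ω) :
    prob P E = ∑ ω, E.indicator (fun ω => (P ω).toReal) ω := by
  rw [prob, PMF.toOuterMeasure_apply_fintype, ENNReal.toReal_sum]
  · refine Finset.sum_congr rfl fun ω _ => ?_
    by_cases h : ω ∈ E <;> simp [h]
  · intro ω _
    by_cases h : ω ∈ E <;> simp [h, P.apply_ne_top]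

lemma prob_nonneg {Ω : Type*} (P : PMF Ω) (E : Set Ω) : 0 ≤ prob P E := ENNReal.toReal_nonneg

lemma prob_pos {Ω : Type*} [Fintype Ω] {P : PMF Ω} {ω : Ω} (hω : P ω ≠ 0) {E : Set Ω}
    (hE : ω ∈ E) : 0 < prob P E := by
  rw [prob_eq_sum]
  refine Finset.sum_pos' (fun ω' _ => Set.indicator_nonneg (fun _ _ => ENNReal.toReal_nonneg) _)
    ⟨ω, Finset.mem_univ _, ?_⟩
  rw [Set.indicator_of_mem hE]
  exact ENNReal.toReal_pos hω (P.apply_ne_top ω)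

/-- The conditional probability `P(A = a | B = b)`. -/
def condProb {Ω α β : Type*} (P : PMF Ω) (A : Ω → α) (B : Ω → β) (a : α) (b : β) : ℝ :=
  prob P {ω | A ω = a ∧ B ω = b} / prob P {ω | B ω = b}

lemma condProb_nonneg {Ω α β : Type*} (P : PMF Ω) (A : Ω → α) (B : Ω → β) (a : α) (b : β) :
    0 ≤ condProb P A B a b := div_nonneg (prob_nonneg _ _) (prob_nonneg _ _)

lemma condProb_pos {Ω α β : Type*} [Fintype Ω] {P : PMF Ω} (A : Ω → α) (B : Ω → β) {ω : Ω}
    (hω : P ω ≠ 0) : 0 < condProb P A B (A ω) (B ω) :=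
  div_pos (prob_pos hω ⟨rfl, rfl⟩) (prob_pos hω rfl)

/-- Only an inequality, because a null conditioning event makes every quotient 0 / 0 = 0. -/
lemma sum_condProb_le_one {Ω α β : Type*} [Fintype Ω] [Fintype α] (P : PMF Ω) (A : Ω → α)
    (B : Ω → β) (b : β) : ∑ a, condProb P A B a b ≤ 1 := by
  classical
  simp only [condProb]
  rw [← Finset.sum_div]
  have : ∑ a, prob P {ω | A ω = a ∧ B ω = b} = prob P {ω | B ω = b} := by
    simp only [prob_eq_sum]
    rw [Finset.sum_comm]
    refine Finset.sum_congr rfl fun ω _ => ?_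
    by_cases h : B ω = b <;> simp [Set.indicator, h]
  rw [this]
  exact div_self_le_one _

/-- The marginal probability of A cancels between the two densities, leaving a ratio of conditional
probabilities. -/
lemma two_rpow_infoDensity {Ω α β γ : Type*} [Fintype Ω] {P : PMF Ω} (A : Ω → α) (B : Ω → β)
    (C : Ω → γ) {ω : Ω} (hω : P ω ≠ 0) :
    (2 : ℝ) ^ (-infoDensity P A B ω + infoDensity P A C ω) =
      condProb P A C (A ω) (C ω) / condProb P A B (A ω) (B ω) := by
  have hA : 0 < prob P {ω' | A ω' = A ω} := prob_pos hω rfl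
  have hB := condProb_pos A B hω
  have hC := condProb_pos A C hω
  have h1 : infoDensity P A B ω =
    Real.logb 2 (condProb P A B (A ω) (B ω) / prob P {ω' | A ω' = A ω}) := rfl
  have h2 : infoDensity P A C ω =
    Real.logb 2 (condProb P A C (A ω) (C ω) / prob P {ω' | A ω' = A ω}) := rfl
  rw [h1, h2, Real.rpow_add two_pos, Real.rpow_neg two_pos.le,
    Real.rpow_logb two_pos (by norm_num) (by positivity),
    Real.rpow_logb two_pos (by norm_num) (by positivity)]
  field_simp

/-! ### Products of kernels -/

/-- If two families of kernels differ only at the index `i₀`, where their total masses have the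
constant ratio `c`, and are normalised at the other indices, then the total masses of the products
have the ratio `c`. -/
lemma sum_prod_eq_mul {N : ℕ} {A : Fin N → Type*} [∀ i, Fintype (A i)] [∀ i, Nonempty (A i)]
    (L L' : ∀ i : Fin N, (∀ j, A j) → A i → ℝ≥0∞)
    (hL : ∀ i t t', (∀ j, j < i → t j = t' j) → L i t = L i t')
    (hL' : ∀ i t t', (∀ j, j < i → t j = t' j) → L' i t = L' i t')
    (i₀ : Fin N) (c : ℝ≥0∞) (hne : ∀ i, i ≠ i₀ → L' i = L i)
    (h1 : ∀ i, i ≠ i₀ → ∀ t, ∑ a, L i t a = 1)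
    (hc : ∀ t, ∑ a, L i₀ t a = c * ∑ a, L' i₀ t a) :
    ∑ t : ∀ i, A i, ∏ i, L i t (t i) = c * ∑ t : ∀ i, A i, ∏ i, L' i t (t i) := by
  induction N with
  | zero => exact i₀.elim0
  | succ n ih =>
    have t0 : ∀ j, A j := fun j => Classical.arbitrary _
    have hcons : ∀ p, Fin.consEquiv A p = Fin.cons p.1 p.2 := fun _ => rfl
    have hs : ∀ M : ∀ i : Fin (n + 1), (∀ j, A j) → A i → ℝ≥0∞,
        (∀ i t t', (∀ j, j < i → t j = t' j) → M i t = M i t') →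
        ∑ t : ∀ i, A i, ∏ i, M i t (t i) = ∑ a : A 0, M 0 t0 a *
          ∑ s : (∀ i : Fin n, A i.succ), ∏ i, M i.succ (Fin.cons a s) (s i) := by
      intro M hM
      rw [← (Fin.consEquiv A).sum_comp, Fintype.sum_prod_type]
      refine Finset.sum_congr rfl fun a _ => ?_
      rw [Finset.mul_sum]
      refine Finset.sum_congr rfl fun s _ => ?_
      rw [hcons, Fin.prod_univ_succ, hM 0 _ t0 fun j hj => absurd hj (Fin.not_lt_zero j)]
      simp only [Fin.cons_zero, Fin.cons_succ]
    have hd : ∀ (M : ∀ i : Fin (n + 1), (∀ j, A j) → A i → ℝ≥0∞),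
        (∀ i t t', (∀ j, j < i → t j = t' j) → M i t = M i t') → ∀ (a : A 0) (i : Fin n)
        (t t' : ∀ i : Fin n, A i.succ), (∀ j, j < i → t j = t' j) →
        M i.succ (Fin.cons a t) = M i.succ (Fin.cons a t') := by
      intro M hM a i t t' h
      refine hM _ _ _ fun j hj => ?_
      induction j using Fin.cases with
      | zero => simp
      | succ j => simpa using h j (by simpa using hj)
    rw [hs L hL, hs L' hL']
    -- If the special index is the first, everything after it integrates to one; otherwise the first
    -- kernels agree and the induction applies to the tail.
    induction i₀ using Fin.cases with
    | zero =>
      have key : ∀ a : A 0,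
          ∑ s : (∀ i : Fin n, A i.succ), ∏ i, L i.succ (Fin.cons a s) (s i) = 1 := fun a =>
        sum_prod_eq_one (fun i s => L i.succ (Fin.cons a s)) (hd L hL a)
          fun i s => h1 _ (Fin.succ_ne_zero i) _
      simp only [fun i : Fin n => hne _ (Fin.succ_ne_zero i), key, mul_one]
      exact hc t0
    | succ i₁ =>
      rw [Finset.mul_sum, hne 0 (Fin.succ_ne_zero i₁).symm]
      refine Finset.sum_congr rfl fun a _ => ?_
      rw [mul_left_comm c]
      congr 1
      refine ih (fun i s => L i.succ (Fin.cons a s)) (fun i s => L' i.succ (Fin.cons a s))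
        (hd L hL a) (hd L' hL' a) i₁ ?_ ?_ fun t => hc _
      · intro i hi
        rw [hne _ (by simpa using hi)]
      · exact fun i hi t => h1 _ (by simpa using hi) _

/-- The total mass of a product of subprobability kernels, each of which depends on the later
coordinates, is at most one. -/
lemma sum_prod_le_one {n : ℕ} {A : Fin n → Type*} [∀ i, Fintype (A i)]
    (L : ∀ i : Fin n, (∀ j, A j) → A i → ℝ) (h0 : ∀ i t a, 0 ≤ L i t a)
    (hL : ∀ i t t', (∀ j, i < j → t j = t' j) → L i t = L i t')
    (h1 : ∀ i t, ∑ a, L i t a ≤ 1) :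
    ∑ t : ∀ i, A i, ∏ i, L i t (t i) ≤ 1 := by
  induction n with
  | zero => simp
  | succ n ih =>
    rcases isEmpty_or_nonempty (A 0) with hA | ⟨⟨a0⟩⟩
    · have : IsEmpty (∀ i, A i) := ⟨fun t => hA.elim (t 0)⟩
      simp
    have hcons : ∀ p, Fin.consEquiv A p = Fin.cons p.1 p.2 := fun _ => rfl
    -- No later kernel depends on the first coordinate, so that coordinate is summed out first.
    rw [← (Fin.consEquiv A).sum_comp, Fintype.sum_prod_type, Finset.sum_comm]
    have hsucc : ∀ (a : A 0) (s : ∀ i : Fin n, A i.succ) (i : Fin n),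
        L i.succ (Fin.cons a s) = L i.succ (Fin.cons a0 s) := by
      intro a s i
      refine hL _ _ _ fun j hj => ?_
      induction j using Fin.cases with
      | zero => exact absurd hj (Fin.not_lt_zero _)
      | succ j => simp
    have h00 : ∀ (a : A 0) (s : ∀ i : Fin n, A i.succ),
        L 0 (Fin.cons a s) = L 0 (Fin.cons a0 s) := by
      intro a s
      refine hL _ _ _ fun j hj => ?_
      induction j using Fin.cases with
      | zero => exact absurd hj (lt_irrefl _)
      | succ j => simp
    calc _ ≤ ∑ s : (∀ i : Fin n, A i.succ), ∏ i, L i.succ (Fin.cons a0 s) (s i) := by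
          refine Finset.sum_le_sum fun s _ => ?_
          simp only [hcons, Fin.prod_univ_succ, Fin.cons_zero, Fin.cons_succ, hsucc, h00]
          rw [← Finset.sum_mul]
          exact mul_le_of_le_one_left (Finset.prod_nonneg fun i _ => h0 _ _ _) (h1 _ _)
      _ ≤ 1 := by
          refine ih (fun i s => L i.succ (Fin.cons a0 s)) (fun i t a => h0 _ _ _) ?_
            fun i t => h1 _ _
          intro i t t' h
          refine hL _ _ _ fun j hj => ?_
          induction j using Fin.cases with
          | zero => simp
          | succ j => simpa using h j (by simpa using hj)

/-! ### The ideal distribution -/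

section

variable {N : ℕ} {X Y U : Fin N → Type*}

lemma idealStep_apply [∀ i, Fintype (X i)] [∀ i, Fintype (Y i)] [∀ i, Fintype (U i)]
    (net : Network N X Y) {o : DecodingOrder N} (laws : NodeLaws o X Y U)
    (i : Fin N) (past : ∀ j : Set.Iio i, X j × Y j × U j) (x : X i) (y : Y i) (u : U i) :
    idealStep net laws i past (x, y, u) =
      net.channel i (fun j => (past j).1) (fun j => (past j).2.1) y *
        (laws.PU i y (fun j => (past ⟨o.a i j, o.a_lt i j⟩).2.2) u *
          laws.PX i y u (fun j => (past ⟨o.a i j, o.a_lt i j⟩).2.2) x) := by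
  classical
  simp only [idealStep, PMF.bind_apply, PMF.map_apply, tsum_fintype, Prod.mk.injEq]
  rw [Finset.sum_eq_single y, Finset.sum_eq_single u, Finset.sum_eq_single x]
  · simp
  · intro b _ hb
    simp [Ne.symm hb]
  · simp
  · intro b _ hb
    simp [Ne.symm hb]
  · simp
  · intro b _ hb
    simp [Ne.symm hb]
  · simp

section

variable [∀ i, Fintype (X i)] [∀ i, Fintype (Y i)] [∀ i, Fintype (U i)]
  (net : Network N X Y) {o : DecodingOrder N} (laws : NodeLaws o X Y U)

lemma ideal_apply (ω : ∀ i, X i × Y i × U i) :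
    ideal net laws ω = ∏ i, (net.channel i (fun j => (ω j).1) (fun j => (ω j).2.1) (rvY i ω) *
      (laws.PU i (rvY i ω) (rvTuple o i (o.uniq i) ω) (rvU i ω) *
        laws.PX i (rvY i ω) (rvU i ω) (rvTuple o i (o.uniq i) ω) (ω i).1)) := by
  rw [ideal, sequential, PMF.ofFintype_apply]
  exact Finset.prod_congr rfl fun i _ => idealStep_apply net laws i _ _ _ _

/-- Under the ideal distribution, `U_i` has the conditional distribution `P_{U_i|Y_i,U'_i}`. -/
lemma condProb_ideal_rvU (i : Fin N) {ω : ∀ i, X i × Y i × U i} (hω : ideal net laws ω ≠ 0)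
    (u : U i) :
    condProb (ideal net laws) (rvU i) (fun ω' => (rvTuple o i (o.uniq i) ω', rvY i ω'))
        u (rvTuple o i (o.uniq i) ω, rvY i ω) =
      (laws.PU i (rvY i ω) (rvTuple o i (o.uniq i) ω) u).toReal := by
  classical
  set u' := rvTuple o i (o.uniq i) ω
  set y := rvY i ω
  have hpos : 0 < prob (ideal net laws)
      {ω' | (rvTuple o i (o.uniq i) ω', rvY i ω') = (u', y)} := prob_pos hω rfl
  rw [condProb, div_eq_iff hpos.ne']
  have hne : ∀ i, Nonempty (X i × Y i × U i) := nonempty_of_kernels (idealStep net laws)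
  let K : ∀ m : Fin N, (∀ j, X j × Y j × U j) → X m × Y m × U m → ℝ≥0∞ :=
    fun m t => idealStep net laws m fun j => t j
  have hK : ∀ m t t', (∀ j, j < m → t j = t' j) → K m t = K m t' := by
    intro m t t' h
    have : (fun j : Set.Iio m => t j) = fun j : Set.Iio m => t' j := funext fun j => h j j.2
    simp only [K, this]
  have hT : ∀ t t' : (∀ j, X j × Y j × U j), (∀ j, j < i → t j = t' j) →
      rvTuple o i (o.uniq i) t = rvTuple o i (o.uniq i) t' := by
    intro t t' h
    funext j
    simp only [rvTuple, rvU, h _ (o.a_lt i j)]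
  -- The event is absorbed into the kernel of node i, which is possible because the tuple of decoded
  -- auxiliaries is a function of the earlier coordinates.
  let V : (X i × Y i × U i → Prop) → ∀ m : Fin N, (∀ j, X j × Y j × U j) →
      X m × Y m × U m → ℝ≥0∞ := fun φ => Function.update K i fun t a =>
    if rvTuple o i (o.uniq i) t = u' ∧ φ a then K i t a else 0
  have hVi : ∀ φ, V φ i = fun t a =>
    if rvTuple o i (o.uniq i) t = u' ∧ φ a then K i t a else 0 := fun φ => by simp [V]
  have hVm : ∀ φ m, m ≠ i → V φ m = K m := fun φ m hm => by simp [V, hm]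
  have hV : ∀ φ m t t', (∀ j, j < m → t j = t' j) → V φ m t = V φ m t' := by
    intro φ m t t' h
    by_cases hm : m = i
    · subst hm
      rw [hVi]
      simp only [hT t t' h, hK m t t' h]
    · rw [hVm φ m hm, hK m t t' h]
  have hsum : ∀ (φ : X i × Y i × U i → Prop), prob (ideal net laws)
      {t | rvTuple o i (o.uniq i) t = u' ∧ φ (t i)} = (∑ t, ∏ m, V φ m t (t m)).toReal := by
    intro φ
    rw [prob, PMF.toOuterMeasure_apply_fintype]
    congr 1
    refine Finset.sum_congr rfl fun t _ => ?_
    rw [← Finset.mul_prod_erase _ _ (Finset.mem_univ i), hVi]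
    have h2 : ∏ m ∈ Finset.univ.erase i, V φ m t (t m) =
        ∏ m ∈ Finset.univ.erase i, K m t (t m) :=
      Finset.prod_congr rfl fun m hm => by rw [hVm φ m (Finset.ne_of_mem_erase hm)]
    rw [h2]
    by_cases h : rvTuple o i (o.uniq i) t = u' ∧ φ (t i)
    · simp only [h, Set.indicator, Set.mem_ofPred_eq, and_self, if_true]
      rw [Finset.mul_prod_erase _ (fun m => K m t (t m)) (Finset.mem_univ i)]
      rfl
    · simp [Set.indicator, h]
  have e1 : {t | rvU i t = u ∧ (rvTuple o i (o.uniq i) t, rvY i t) = (u', y)} =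
      {t : ∀ i, X i × Y i × U i | rvTuple o i (o.uniq i) t = u' ∧
        (fun a : X i × Y i × U i => a.2.2 = u ∧ a.2.1 = y) (t i)} := by
    ext t
    simp only [Prod.mk.injEq, Set.mem_ofPred_eq, rvU, rvY]
    tauto
  have e2 : {t | (rvTuple o i (o.uniq i) t, rvY i t) = (u', y)} =
      {t : ∀ i, X i × Y i × U i | rvTuple o i (o.uniq i) t = u' ∧
        (fun a : X i × Y i × U i => a.2.1 = y) (t i)} := by
    ext t
    simp only [Prod.mk.injEq, Set.mem_ofPred_eq, rvY]
  rw [(congrArg (prob (ideal net laws)) e1).trans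
      (hsum fun a : X i × Y i × U i => a.2.2 = u ∧ a.2.1 = y),
    (congrArg (prob (ideal net laws)) e2).trans (hsum fun a : X i × Y i × U i => a.2.1 = y),
    ← ENNReal.toReal_mul]
  congr 1
  -- Numerator and denominator now differ only at node i, where summing out x, respectively x and
  -- the auxiliary, gives the constant ratio P_{U_i|Y_i,U'_i}(u).
  refine sum_prod_eq_mul _ _ (hV _) (hV _) i _ (fun m hm => by rw [hVm _ m hm, hVm _ m hm]) ?_ ?_
  · intro m hm t
    rw [hVm _ m hm, ← tsum_fintype (L := .unconditional _)]
    exact PMF.tsum_coe _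
  · intro t
    simp only [hVi]
    by_cases h : rvTuple o i (o.uniq i) t = u'
    swap
    · simp [h]
    have h' : (fun j : o.uniq i => (t (o.a i j)).2.2) = u' := h
    have hPX : ∀ u'', ∑ x, laws.PX i y u'' u' x = 1 := fun u'' => by
      rw [← tsum_fintype (L := .unconditional _)]
      exact PMF.tsum_coe _
    have hPU : ∑ u'', laws.PU i y u' u'' = 1 := by
      rw [← tsum_fintype (L := .unconditional _)]
      exact PMF.tsum_coe _
    have hx : ∀ u'', ∑ x, K i t (x, y, u'') =
        net.channel i (fun j => (t j).1) (fun j => (t j).2.1) y * laws.PU i y u' u'' := by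
      intro u''
      simp only [K, idealStep_apply, h']
      rw [← Finset.mul_sum, ← Finset.mul_sum, hPX, mul_one]
    simp only [h, true_and, Fintype.sum_prod_type]
    rw [Finset.sum_comm]
    have l1 : ∑ y', ∑ x, ∑ u'', (if u'' = u ∧ y' = y then K i t (x, y', u'') else 0) =
        ∑ x, K i t (x, y, u) := by
      rw [Finset.sum_eq_single y (fun y' _ hy' => by simp [hy']) (by simp)]
      simp
    have l2 : ∑ x, ∑ y', ∑ u'', (if y' = y then K i t (x, y', u'') else 0) =
        ∑ u'', ∑ x, K i t (x, y, u'') := by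
      rw [Finset.sum_comm, Finset.sum_eq_single y (fun y' _ hy' => by simp [hy']) (by simp)]
      simp only [if_true]
      rw [Finset.sum_comm]
    rw [l1, l2, hx]
    simp only [hx]
    rw [← Finset.mul_sum, hPU, mul_one, mul_comm]

end

end

open MeasureTheory

/-! ### Decoding by successive refinement -/

section

variable {N : ℕ} {X Y U : Fin N → Type*} (P : PMF (∀ i, X i × Y i × U i)) (o : DecodingOrder N)
  (i : Fin N)

/-- The conditional law of the `k`-th auxiliary used by node `i`, given `Y_i` and the auxiliaries
whose positions are not in `[j..k]`. -/
def auxCond (j k : Fin (o.d i)) (y : Y i) (t : ∀ l, U (o.a i l)) (v : U (o.a i k)) : ℝ :=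
  condProb P (rvU (o.a i k))
    (fun ω => (rvTuple o i (Finset.univ \ Finset.Icc j k) ω, rvY i ω)) v (fun l => t l, y)

lemma auxCond_nonneg (j k : Fin (o.d i)) (y : Y i) (t : ∀ l, U (o.a i l)) (v : U (o.a i k)) :
    0 ≤ auxCond P o i j k y t v := condProb_nonneg _ _ _ _ _

/-- For fixed values before j, the law at position k depends only on later positions; this
triangular structure lets the weights be summed from j upwards. -/
lemma auxCond_congr {j k : Fin (o.d i)} (y : Y i) {t t' : ∀ l, U (o.a i l)}
    (h : ∀ l, l < j ∨ k < l → t l = t' l) : auxCond P o i j k y t = auxCond P o i j k y t' := by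
  have h' : (fun l : (Finset.univ \ Finset.Icc j k : Finset (Fin (o.d i))) => t l) =
      fun l : (Finset.univ \ Finset.Icc j k : Finset (Fin (o.d i))) => t' l := by
    funext l
    refine h l ?_
    have := l.2
    simp only [Finset.mem_sdiff, Finset.mem_univ, Finset.mem_Icc, true_and, not_and_or,
      not_le] at this
    exact this
  funext v
  simp only [auxCond, h']

variable [∀ i, Fintype (U i)]

/-- The weight of the tuple `t` in the decoding of the `j`-th auxiliary by node `i`: the laws of
the auxiliaries after the `j`-th one are replaced by their refinements. -/
def tupleWeight (j : Fin (o.d i)) (y : Y i) (t : ∀ l, U (o.a i l)) (z : ∀ m, U m → ℝ) : ℝ :=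
  auxCond P o i j j y t (t j) * ∏ k ∈ Finset.Ioi j,
    ((Real.log (Fintype.card (U (o.a i k))) + 1) *
      rank (auxCond P o i j k y t) (z (o.a i k)) (t k))⁻¹

/-- The rates used by node `i` for decoding the `j`-th auxiliary, given the auxiliaries `u` decoded
before. -/
def decodingRate (j : Fin (o.d i)) (y : Y i) (u : o.Tuple U i (o.uniq i)) (z : ∀ m, U m → ℝ)
    (v : U (o.a i j)) : ℝ :=
  open Classical in ∑ t : ∀ l, U (o.a i l),
    if (∀ l : o.uniq i, l < j → t l = u l) ∧ t j = v then tupleWeight P o i j y t z else 0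

lemma log_card_add_one_pos (m : Fin N) : 0 < Real.log (Fintype.card (U m)) + 1 := by
  have := Real.log_natCast_nonneg (Fintype.card (U m))
  linarith

lemma tupleWeight_nonneg (j : Fin (o.d i)) (y : Y i) (t : ∀ l, U (o.a i l))
    (z : ∀ m, U m → ℝ) : 0 ≤ tupleWeight P o i j y t z :=
  mul_nonneg (auxCond_nonneg _ _ _ _ _ _ _ _) <| Finset.prod_nonneg fun _ _ =>
    inv_nonneg.2 <| mul_nonneg (log_card_add_one_pos _).le (Nat.cast_nonneg _)

lemma decodingRate_nonneg (j : Fin (o.d i)) (y : Y i) (u : o.Tuple U i (o.uniq i))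
    (z : ∀ m, U m → ℝ) (v : U (o.a i j)) : 0 ≤ decodingRate P o i j y u z v := by
  refine Finset.sum_nonneg fun t _ => ?_
  split_ifs
  · exact tupleWeight_nonneg _ _ _ _ _ _ _
  · exact le_rfl

lemma tupleWeight_le_decodingRate (j : Fin (o.d i)) (y : Y i) (t : ∀ l, U (o.a i l))
    (z : ∀ m, U m → ℝ) :
    tupleWeight P o i j y t z ≤ decodingRate P o i j y (fun l => t l) z (t j) := by
  classical
  refine le_trans (le_of_eq ?_) (Finset.single_le_sum (fun t _ => ?_) (Finset.mem_univ t))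
  · simp
  · split_ifs
    · exact tupleWeight_nonneg _ _ _ _ _ _ _
    · exact le_rfl

/-- The rates involve neither undecided entries nor the clock being raced at position j: the former
makes sequential decoding well defined, the latter makes the rates independent of that clock. -/
lemma decodingRate_congr {j : Fin (o.d i)} (y : Y i) {u u' : o.Tuple U i (o.uniq i)}
    (hu : ∀ l : o.uniq i, l < j → u l = u' l) {z z' : ∀ m, U m → ℝ}
    (hz : ∀ k, j < k → z (o.a i k) = z' (o.a i k)) :
    decodingRate P o i j y u z = decodingRate P o i j y u' z' := by
  classical
  funext v
  refine Finset.sum_congr rfl fun t _ => ?_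
  have h1 : (∀ l : o.uniq i, l < j → t l = u l) ↔ ∀ l : o.uniq i, l < j → t l = u' l :=
    forall₂_congr fun l hl => by rw [hu l hl]
  have h2 : tupleWeight P o i j y t z = tupleWeight P o i j y t z' := by
    rw [tupleWeight, tupleWeight]
    congr 1
    exact Finset.prod_congr rfl fun k hk => by rw [hz k (Finset.mem_Ioi.1 hk)]
  simp only [h1, h2]

lemma sum_auxCond_le_one [∀ i, Fintype (X i)] [∀ i, Fintype (Y i)] (j k : Fin (o.d i)) (y : Y i)
    (t : ∀ l, U (o.a i l)) : ∑ v, auxCond P o i j k y t v ≤ 1 :=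
  sum_condProb_le_one _ _ _ _

/-- The weights form a product of subprobability kernels, each depending on later positions only; a
rank factor has mass at most one by the harmonic bound. -/
lemma sum_decodingRate_le_one [∀ i, Fintype (X i)] [∀ i, Fintype (Y i)] {j : Fin (o.d i)}
    (hj : j ∈ o.uniq i) (y : Y i) (u : o.Tuple U i (o.uniq i)) (z : ∀ m, U m → ℝ) :
    ∑ v, decodingRate P o i j y u z v ≤ 1 := by
  classical
  -- The uniquely decoded positions form an initial segment, so `u` supplies every entry before j.
  have hmem : ∀ l, l < j → l ∈ o.uniq i := fun l hl => by
    simp only [DecodingOrder.uniq, Finset.mem_filter, Finset.mem_univ, true_and] at hj ⊢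
    exact lt_trans (Fin.lt_def.1 hl) hj
  -- Overwriting the entries before j by the known ones removes the dependence of the kernels on
  -- earlier coordinates; those positions get point masses.
  let mix : (∀ l, U (o.a i l)) → ∀ l, U (o.a i l) := fun t l =>
    if h : l < j then u ⟨l, hmem l h⟩ else t l
  let L : ∀ l : Fin (o.d i), (∀ l, U (o.a i l)) → U (o.a i l) → ℝ := fun l t a =>
    if h : l < j then if a = u ⟨l, hmem l h⟩ then 1 else 0
    else if l = j then auxCond P o i j l y (mix t) a
    else ((Real.log (Fintype.card (U (o.a i l))) + 1) *
      rank (auxCond P o i j l y (mix t)) (z (o.a i l)) a)⁻¹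
  have hL0 : ∀ l t a, 0 ≤ L l t a := by
    intro l t a
    simp only [L]
    split_ifs
    · exact zero_le_one
    · exact le_rfl
    · exact auxCond_nonneg _ _ _ _ _ _ _ _
    · exact inv_nonneg.2 <| mul_nonneg (log_card_add_one_pos _).le (Nat.cast_nonneg _)
  calc ∑ v, decodingRate P o i j y u z v
      = ∑ t, if ∀ l : o.uniq i, l < j → t l = u l then tupleWeight P o i j y t z else 0 := by
        simp only [decodingRate]
        rw [Finset.sum_comm]
        refine Finset.sum_congr rfl fun t _ => ?_
        refine (Finset.sum_eq_single (t j) (fun v _ hv => if_neg fun h => hv h.2.symm)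
          (by simp)).trans ?_
        simp only [and_true]
    _ ≤ ∑ t, ∏ l, L l t (t l) := by
        refine Finset.sum_le_sum fun t _ => ?_
        split_ifs with h
        swap
        · exact Finset.prod_nonneg fun l _ => hL0 _ _ _
        have hmix : mix t = t := by
          funext l
          simp only [mix]
          split_ifs with hl
          · exact (h ⟨l, hmem l hl⟩ hl).symm
          · rfl
        have hsub : ∏ l, L l t (t l) = ∏ l ∈ Finset.Ici j, L l t (t l) := by
          refine (Finset.prod_subset (Finset.subset_univ _) fun l _ hl => ?_).symm
          have hl' : l < j := by simpa using hl
          simp [L, hl', h ⟨l, hmem l hl'⟩ hl']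
        rw [hsub, ← Finset.Ioi_insert, Finset.prod_insert (by simp), tupleWeight]
        refine le_of_eq ?_
        congr 1
        · simp [L, hmix]
        · refine Finset.prod_congr rfl fun k hk => ?_
          have hk' : j < k := Finset.mem_Ioi.1 hk
          simp [L, hmix, not_lt_of_gt hk', hk'.ne']
    _ ≤ 1 := by
        refine sum_prod_le_one L hL0 ?_ ?_
        · intro l t t' h
          have hm : ¬ l < j → auxCond P o i j l y (mix t) = auxCond P o i j l y (mix t') := by
            refine fun hl => auxCond_congr P o i y fun m hm => ?_
            simp only [mix]
            split_ifs with hmj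
            · rfl
            · exact h m (hm.resolve_left hmj)
          funext a
          simp only [L]
          split_ifs with h1 h2 h3
          · rfl
          · rfl
          · rw [hm h1]
          · rw [hm h1]
        · intro l t
          simp only [L]
          split_ifs with h1 h2
          · simp
          · exact sum_auxCond_le_one _ _ _ _ _ _ _
          · simp only [mul_inv]
            rw [← Finset.mul_sum]
            have hpos := log_card_add_one_pos (U := U) (o.a i l)
            rw [inv_mul_le_iff₀ hpos, mul_one]
            exact sum_inv_rank_le _ _

lemma measurable_rank {ι : Type*} [Fintype ι] (q : ι → ℝ) (u : ι) :
    Measurable fun z : ι → ℝ => rank q z u := by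
  classical
  simp only [rank, Finset.card_filter]
  refine Finset.measurable_fun_sum _ fun v _ => Measurable.ite ?_ measurable_const measurable_const
  exact measurableSet_le (by fun_prop) (by fun_prop)

lemma measurable_decodingRate (j : Fin (o.d i)) (y : Y i) (u : o.Tuple U i (o.uniq i))
    (v : U (o.a i j)) : Measurable fun z => decodingRate P o i j y u z v := by
  classical
  have hr : ∀ (t : ∀ l, U (o.a i l)) k, Measurable fun z : ∀ m, U m → ℝ =>
      (rank (auxCond P o i j k y t) (z (o.a i k)) (t k) : ℝ) := fun t k =>
    measurable_from_top.comp ((measurable_rank _ _).comp (measurable_pi_apply _))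
  simp only [decodingRate, tupleWeight]
  refine Finset.measurable_fun_sum _ fun t _ => ?_
  split_ifs
  · exact measurable_const.mul (Finset.measurable_fun_prod _ fun k _ =>
      (measurable_const.mul (hr t k)).inv)
  · exact measurable_const

end

/-! ### The coding scheme -/

section

variable {N : ℕ} {X Y U : Fin N → Type*}
  [∀ i, Fintype (X i)] [∀ i, Fintype (U i)]

/-- The clocks attached to node `m`. -/
abbrev Clock (X U : Fin N → Type*) [∀ i, Fintype (X i)] [∀ i, Fintype (U i)] (m : Fin N) : Type :=
  (Fin (Fintype.card (U m)) → ℝ) × (Fin (Fintype.card (X m)) → ℝ)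

/-- The clocks of the values of `U_m`. -/
def clockU (w : ∀ m, Clock X U m) (m : Fin N) : U m → ℝ := (w m).1 ∘ Fintype.equivFin (U m)

lemma measurable_clockU : Measurable (clockU : (∀ m, Clock X U m) → ∀ m, U m → ℝ) := by
  refine measurable_pi_lambda _ fun m => measurable_pi_lambda _ fun u => ?_
  exact (measurable_pi_apply _).comp (measurable_fst.comp (measurable_pi_apply _))

lemma measurableSet_setOf_wins {Ω ι : Type*} [MeasurableSpace Ω] [Finite ι] {p z : Ω → ι → ℝ}
    (hp : Measurable p) (hz : Measurable z) (u : ι) :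
    MeasurableSet {w | Wins (p w) (z w) u} := by
  have hp' := measurable_pi_iff.1 hp
  have hz' := measurable_pi_iff.1 hz
  have : {w | Wins (p w) (z w) u} =
      ⋂ v, ⋂ (_ : v ≠ u), {w | p w v * z w u < p w u * z w v} := by
    ext; simp [Wins]
  rw [this]
  exact MeasurableSet.iInter fun v => MeasurableSet.iInter fun _ =>
    measurableSet_lt ((hp' v).mul (hz' u)) ((hp' u).mul (hz' v))

variable {o : DecodingOrder N}

/-- The auxiliary `u` and the input `x` are selected by node `i`. -/
def Selects (laws : NodeLaws o X Y U) (i : Fin N) (y : Y i) (c : Clock X U i) (u' : o.Tuple U i (o.uniq i))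
    (u : U i) (x : X i) : Prop :=
  Wins (fun u => (laws.PU i y u' u).toReal) (c.1 ∘ Fintype.equivFin (U i)) u ∧
    Wins (fun x => (laws.PX i y u u' x).toReal) (c.2 ∘ Fintype.equivFin (X i)) x

lemma measurableSet_selects (laws : NodeLaws o X Y U) (i : Fin N) (y : Y i) (u' : o.Tuple U i (o.uniq i))
    (u : U i) (x : X i) : MeasurableSet {c | Selects laws i y c u' u x} := by
  refine measurableSet_setOf_and (measurableSet_setOf_wins measurable_const ?_ _)
    (measurableSet_setOf_wins measurable_const ?_ _)
  · exact measurable_pi_lambda _ fun v => (measurable_pi_apply _).comp measurable_fst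
  · exact measurable_pi_lambda _ fun v => (measurable_pi_apply _).comp measurable_snd

variable [∀ i, Fintype (Y i)] (net : Network N X Y) (laws : NodeLaws o X Y U)

/-- The `j`-th auxiliary `u' j` is correctly decoded by node `i` from the received value `y`, if
the auxiliaries before are the entries of `u'`. -/
def Decodes (i : Fin N) (y : Y i) (w : ∀ m, Clock X U m) (u' : o.Tuple U i (o.uniq i))
    (j : o.uniq i) : Prop :=
  Wins (decodingRate (ideal net laws) o i j y u' (clockU w)) (clockU w (o.a i j)) (u' j)

/-- The possible results of the operation of node `i`. -/
def nodeResults (i : Fin N) (y : Y i) (w : ∀ m, Clock X U m) :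
    Set (o.Tuple U i (o.uniq i) × U i × X i) :=
  {s | (∀ j, Decodes net laws i y w s.1 j) ∧ Selects laws i y (w i) s.1 s.2.1 s.2.2}

lemma measurableSet_decodes (i : Fin N) (y : Y i) (u' : o.Tuple U i (o.uniq i))
    (j : o.uniq i) : MeasurableSet {w | Decodes net laws i y w u' j} := by
  refine measurableSet_setOf_wins ?_ ?_ _
  · exact measurable_pi_lambda _ fun v =>
      (measurable_decodingRate _ o i j y u' v).comp measurable_clockU
  · exact (measurable_pi_apply _).comp measurable_clockU

/-- Winners are unique, and once the entries before j agree, so do the rates of the race for entry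
j. -/
lemma nodeResults_subsingleton (i : Fin N) (y : Y i) (w : ∀ m, Clock X U m) :
    (nodeResults net laws i y w).Subsingleton := by
  rintro ⟨u', u, x⟩ ⟨hd, hu, hx⟩ ⟨v', v, x'⟩ ⟨hd', hv, hx'⟩
  dsimp only at hd hu hx hd' hv hx'
  have key : ∀ j : o.uniq i, u' j = v' j := by
    intro j
    induction j using WellFoundedLT.induction with
    | ind j ih =>
      have h1 := hd j
      have h2 := hd' j
      rw [Decodes, decodingRate_congr (z' := clockU w) (ideal net laws) o i y
        (fun l hl => ih l hl) fun k _ => rfl] at h1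
      exact h1.unique h2
  obtain rfl : u' = v' := funext key
  obtain rfl := hu.unique hv
  obtain rfl := hx.unique hx'
  rfl

/-- The selection of an input from the set of results. -/
def chooseInput [∀ i, Nonempty (X i)] (o : DecodingOrder N) (i : Fin N)
    (R : Set (o.Tuple U i (o.uniq i) × U i × X i)) : X i :=
  open Classical in if h : R.Nonempty then h.some.2.2 else Classical.arbitrary _

/-- The law of the clocks of node `m`. -/
abbrev clockLaw (X U : Fin N → Type*) [∀ i, Fintype (X i)] [∀ i, Fintype (U i)] (m : Fin N) :
    Measure (Clock X U m) :=
  (Measure.pi fun _ => stdExp).prod (Measure.pi fun _ => stdExp)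

/-- The scheme in which the nodes decode by successive refinement and use the exponential race for
selecting their auxiliaries and inputs. -/
def raceScheme [∀ i, Nonempty (X i)] : PublicScheme X Y where
  -- The clocks are indexed by `Fin`, not by the alphabets, so that the space lies in `Type`
  -- whatever the universes of X and U.
  W := ∀ m, Clock X U m
  PW := Measure.pi (clockLaw X U)
  f i y w := chooseInput o i (nodeResults net laws i y w)
  measurable_f i y := by
    have hmeas : Measurable fun w => nodeResults net laws i y w := by
      refine measurable_set_iff.2 fun s => measurableSet_setOfPred.1 ?_
      have h1 : MeasurableSet {w | ∀ j, Decodes net laws i y w s.1 j} := by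
        have : {w | ∀ j, Decodes net laws i y w s.1 j} =
            ⋂ j, {w | Decodes net laws i y w s.1 j} := by ext; simp
        rw [this]
        exact MeasurableSet.iInter fun j => measurableSet_decodes net laws i y s.1 j
      exact measurableSet_setOf_and h1
        ((measurable_pi_apply i) (measurableSet_selects laws i y s.1 s.2.1 s.2.2))
    let _ : MeasurableSpace (X i) := ⊤
    -- There are finitely many possible result sets, so any choice from them is measurable.
    exact (measurable_of_countable (chooseInput o i)).comp hmeas

end

/-! ### Integration over product spaces -/

lemma lintegral_pi_le_of_update {ι : Type*} [Fintype ι] [DecidableEq ι] {Ω : ι → Type*}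
    [∀ i, MeasurableSpace (Ω i)] (ν : ∀ i, Measure (Ω i)) [∀ i, SigmaFinite (ν i)] (a : ι)
    {f g : (∀ i, Ω i) → ℝ≥0∞} (hf : Measurable f) (hg : Measurable g)
    (h : ∀ w, ∫⁻ x, f (Function.update w a x) ∂ν a ≤ ∫⁻ x, g (Function.update w a x) ∂ν a) :
    ∫⁻ w, f w ∂Measure.pi ν ≤ ∫⁻ w, g w ∂Measure.pi ν := by
  refine lintegral_le_of_lmarginal_le {a} hf hg ?_
  rw [lmarginal_singleton, lmarginal_singleton]
  exact h

/-- Independence, with injectivity of `a` putting the factors on distinct coordinates. The total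
masses are carried along because the restricted clock laws are not normalised. -/
lemma lintegral_pi_prod_le {ι κ : Type*} [Fintype ι] {Ω : ι → Type*}
    [∀ i, MeasurableSpace (Ω i)] (ν : ∀ i, Measure (Ω i)) [∀ i, SigmaFinite (ν i)] {a : κ → ι}
    (ha : Function.Injective a) {ρ : ∀ k, Ω (a k) → ℝ≥0∞} (hρ : ∀ k, Measurable (ρ k))
    (β : κ → ℝ≥0∞) (s : Finset κ)
    (h : ∀ k ∈ s, ∫⁻ x, ρ k x ∂ν (a k) ≤ ν (a k) Set.univ * β k) :
    ∫⁻ w, ∏ k ∈ s, ρ k (w (a k)) ∂Measure.pi ν ≤ Measure.pi ν Set.univ * ∏ k ∈ s, β k := by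
  classical
  have hm : ∀ s : Finset κ, Measurable fun w : ∀ i, Ω i => ∏ k ∈ s, ρ k (w (a k)) := fun s =>
    Finset.measurable_fun_prod _ fun k _ => (hρ k).comp (measurable_pi_apply _)
  induction s using Finset.induction_on with
  | empty => simp
  | insert k s hk ih =>
    have hup : ∀ (w : ∀ i, Ω i) x, ∏ l ∈ s, ρ l (Function.update w (a k) x (a l)) =
        ∏ l ∈ s, ρ l (w (a l)) := by
      refine fun w x => Finset.prod_congr rfl fun l hl => ?_
      rw [Function.update_of_ne]
      exact ha.ne (by rintro rfl; exact hk hl)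
    calc _ ≤ ∫⁻ w, β k * ∏ l ∈ s, ρ l (w (a l)) ∂Measure.pi ν := by
          refine lintegral_pi_le_of_update ν (a k) (hm _) (measurable_const.mul (hm s)) fun w => ?_
          simp only [Finset.prod_insert hk, hup, Function.update_self, lintegral_const]
          rw [lintegral_mul_const _ (hρ k), mul_comm (β k), mul_assoc, mul_comm]
          gcongr
          rw [mul_comm]
          exact h k (Finset.mem_insert_self _ _)
      _ ≤ _ := by
          rw [lintegral_const_mul _ (hm s), Finset.prod_insert hk, mul_left_comm]
          gcongr
          exact ih fun l hl => h l (Finset.mem_insert_of_mem hl)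

/-! ### Races on general index sets -/

section

variable {ι : Type*} [Fintype ι] {n : ℕ} (e : ι ≃ Fin n)

lemma rank_comp_equiv (q : ι → ℝ) (z : Fin n → ℝ) (u : ι) :
    rank q (z ∘ e) u = rank (q ∘ e.symm) z (e u) := by
  classical
  rw [rank, rank]
  refine Finset.card_bij (fun v _ => e v) ?_ ?_ ?_
  · intro v hv
    simpa using hv
  · intro v _ v' _ h
    exact e.injective h
  · intro v hv
    exact ⟨e.symm v, by simpa using hv, by simp⟩

variable {p q : ι → ℝ} (hp : ∀ v, 0 ≤ p v) (h1 : ∑ v, p v = 1) (hq : ∀ v, 0 ≤ q v)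
  (hq1 : ∑ v, q v ≤ 1) {u : ι} (hqu : 0 < q u)

include hp h1

lemma pi_stdExp_wins_equiv :
    Measure.pi (fun _ : Fin n => stdExp) {z | Wins p (z ∘ e) u} = ENNReal.ofReal (p u) := by
  have h1' : ∑ v, (p ∘ e.symm) v = 1 := by rw [← h1]; exact e.symm.sum_comp p
  simp only [Wins.comp_equiv]
  rw [pi_stdExp_wins (p := p ∘ e.symm) (fun v => hp _) h1']
  simp

include hq hq1 hqu

lemma pi_stdExp_wins_and_not_wins_equiv :
    Measure.pi (fun _ : Fin n => stdExp) {z | Wins p (z ∘ e) u ∧ ¬ Wins q (z ∘ e) u} ≤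
      ENNReal.ofReal (p u) * ENNReal.ofReal (p u / q u) := by
  have h1' : ∑ v, (p ∘ e.symm) v = 1 := by rw [← h1]; exact e.symm.sum_comp p
  have hq1' : ∑ v, (q ∘ e.symm) v ≤ 1 := by rwa [show ∑ v, (q ∘ e.symm) v = ∑ v, q v from
    e.symm.sum_comp q]
  simp only [Wins.comp_equiv]
  refine (pi_stdExp_wins_and_not_wins (fun v => hp _) h1' (fun v => hq _) hq1'
    (u := e u) (by simpa using hqu)).trans ?_
  simp

lemma lintegral_wins_rank_equiv :
    ∫⁻ z, {z | Wins p (z ∘ e) u}.indicator (fun z => (rank q (z ∘ e) u : ℝ≥0∞)) z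
        ∂Measure.pi (fun _ : Fin n => stdExp) ≤
      ENNReal.ofReal (p u) * ENNReal.ofReal (p u / q u + 1) := by
  have h1' : ∑ v, (p ∘ e.symm) v = 1 := by rw [← h1]; exact e.symm.sum_comp p
  have hq1' : ∑ v, (q ∘ e.symm) v ≤ 1 := by rwa [show ∑ v, (q ∘ e.symm) v = ∑ v, q v from
    e.symm.sum_comp q]
  simp only [Wins.comp_equiv, rank_comp_equiv]
  refine (lintegral_wins_rank (fun v => hp _) h1' (fun v => hq _) hq1'
    (u := e u) (by simpa using hqu)).trans ?_
  simp

end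

lemma sum_toReal_eq_one {α : Type*} [Fintype α] (P : PMF α) : ∑ a, (P a).toReal = 1 := by
  rw [← ENNReal.toReal_sum fun a _ => P.apply_ne_top a, ← tsum_fintype (L := .unconditional _),
    PMF.tsum_coe, ENNReal.toReal_one]

/-! ### The clocks under which a node follows a given outcome -/

section

variable {N : ℕ} {X Y U : Fin N → Type*} [∀ i, Fintype (X i)] [∀ i, Fintype (U i)]
  {o : DecodingOrder N} (laws : NodeLaws o X Y U) (m : Fin N) (ω : ∀ i, X i × Y i × U i)

/-- The clocks of node `m` for which it selects the values in the outcome `ω`. -/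
def followSet : Set (Clock X U m) :=
  {c | Selects laws m (rvY m ω) c (rvTuple o m (o.uniq m) ω) (rvU m ω) (ω m).1}

/-- The law of the clocks of node `m` restricted to those for which it follows `ω`. -/
def followLaw : Measure (Clock X U m) := (clockLaw X U m).restrict (followSet laws m ω)

instance : IsFiniteMeasure (followLaw laws m ω) := by
  unfold followLaw; infer_instance

/-- The probability with which node `m` selects its auxiliary along `ω`. -/
def auxProb : ℝ := (laws.PU m (rvY m ω) (rvTuple o m (o.uniq m) ω) (rvU m ω)).toReal

/-- Along a fixed ω, the races for the auxiliary and for the input use separate clocks. -/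
lemma followLaw_eq : followLaw laws m ω =
    ((Measure.pi fun _ => stdExp).restrict {z | Wins
      (fun u => (laws.PU m (rvY m ω) (rvTuple o m (o.uniq m) ω) u).toReal)
        (z ∘ Fintype.equivFin (U m)) (rvU m ω)}).prod
    ((Measure.pi fun _ => stdExp).restrict {z | Wins
      (fun x => (laws.PX m (rvY m ω) (rvU m ω) (rvTuple o m (o.uniq m) ω) x).toReal)
        (z ∘ Fintype.equivFin (X m)) (ω m).1}) := by
  rw [Measure.prod_restrict]
  rfl

lemma followLaw_univ : followLaw laws m ω Set.univ =
    ENNReal.ofReal (auxProb laws m ω) *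
      laws.PX m (rvY m ω) (rvU m ω) (rvTuple o m (o.uniq m) ω) (ω m).1 := by
  rw [followLaw_eq, ← Set.univ_prod_univ, Measure.prod_prod, Measure.restrict_apply_univ,
    Measure.restrict_apply_univ,
    pi_stdExp_wins_equiv _ (fun _ => ENNReal.toReal_nonneg) (sum_toReal_eq_one _),
    pi_stdExp_wins_equiv _ (fun _ => ENNReal.toReal_nonneg) (sum_toReal_eq_one _),
    ENNReal.ofReal_toReal (PMF.apply_ne_top (laws.PX m _ _ _) _)]
  rfl

lemma lintegral_followLaw {h : (Fin (Fintype.card (U m)) → ℝ) → ℝ≥0∞} (hh : Measurable h) :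
    ∫⁻ c, h c.1 ∂followLaw laws m ω = (∫⁻ z, {z | Wins
      (fun u => (laws.PU m (rvY m ω) (rvTuple o m (o.uniq m) ω) u).toReal)
        (z ∘ Fintype.equivFin (U m)) (rvU m ω)}.indicator h z ∂Measure.pi fun _ => stdExp) *
      laws.PX m (rvY m ω) (rvU m ω) (rvTuple o m (o.uniq m) ω) (ω m).1 := by
  have hm : MeasurableSet {z : Fin (Fintype.card (U m)) → ℝ | Wins
      (fun u => (laws.PU m (rvY m ω) (rvTuple o m (o.uniq m) ω) u).toReal)
        (z ∘ Fintype.equivFin (U m)) (rvU m ω)} :=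
    measurableSet_setOf_wins measurable_const
      (measurable_pi_lambda _ fun v => measurable_pi_apply _) _
  have := lintegral_prod_mul (μ := (Measure.pi fun _ => stdExp).restrict {z | Wins
      (fun u => (laws.PU m (rvY m ω) (rvTuple o m (o.uniq m) ω) u).toReal)
        (z ∘ Fintype.equivFin (U m)) (rvU m ω)})
    (ν := (Measure.pi fun _ => stdExp).restrict {z | Wins
      (fun x => (laws.PX m (rvY m ω) (rvU m ω) (rvTuple o m (o.uniq m) ω) x).toReal)
        (z ∘ Fintype.equivFin (X m)) (ω m).1}) (f := h) (g := fun _ => 1) hh.aemeasurable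
        aemeasurable_const
  simp only [mul_one, lintegral_const, one_mul, Measure.restrict_apply_univ,
    lintegral_indicator hm] at this ⊢
  rw [followLaw_eq, this,
    pi_stdExp_wins_equiv _ (fun _ => ENNReal.toReal_nonneg) (sum_toReal_eq_one _),
    ENNReal.ofReal_toReal (PMF.apply_ne_top _ _)]

variable {q : U m → ℝ} (hq : ∀ v, 0 ≤ q v) (hq1 : ∑ v, q v ≤ 1) (hqu : 0 < q (rvU m ω))

include hq hq1 hqu

lemma followLaw_not_wins :
    followLaw laws m ω {c | ¬ Wins q (c.1 ∘ Fintype.equivFin (U m)) (rvU m ω)} ≤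
      followLaw laws m ω Set.univ * ENNReal.ofReal (auxProb laws m ω / q (rvU m ω)) := by
  have hm : MeasurableSet {z : Fin (Fintype.card (U m)) → ℝ |
      ¬ Wins q (z ∘ Fintype.equivFin (U m)) (rvU m ω)} :=
    (measurableSet_setOf_wins measurable_const
      (measurable_pi_lambda _ fun v => measurable_pi_apply _) _).compl
  have hA : MeasurableSet {z : Fin (Fintype.card (U m)) → ℝ | Wins
      (fun u => (laws.PU m (rvY m ω) (rvTuple o m (o.uniq m) ω) u).toReal)
        (z ∘ Fintype.equivFin (U m)) (rvU m ω)} :=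
    measurableSet_setOf_wins measurable_const
      (measurable_pi_lambda _ fun v => measurable_pi_apply _) _
  have h1 : followLaw laws m ω {c | ¬ Wins q (c.1 ∘ Fintype.equivFin (U m)) (rvU m ω)} =
      ∫⁻ c, ({z : Fin (Fintype.card (U m)) → ℝ |
        ¬ Wins q (z ∘ Fintype.equivFin (U m)) (rvU m ω)}.indicator 1 c.1 : ℝ≥0∞)
        ∂followLaw laws m ω :=
    (lintegral_indicator_one (measurable_fst hm)).symm
  rw [h1, lintegral_followLaw laws m ω (measurable_one.indicator hm), followLaw_univ, mul_right_comm]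
  gcongr
  rw [Set.indicator_indicator, lintegral_indicator_one (hA.inter hm)]
  exact pi_stdExp_wins_and_not_wins_equiv _ (fun _ => ENNReal.toReal_nonneg) (sum_toReal_eq_one _)
    hq hq1 hqu

lemma lintegral_followLaw_rank :
    ∫⁻ c, (rank q (c.1 ∘ Fintype.equivFin (U m)) (rvU m ω) : ℝ≥0∞) ∂followLaw laws m ω ≤
      followLaw laws m ω Set.univ * ENNReal.ofReal (auxProb laws m ω / q (rvU m ω) + 1) := by
  have hr : Measurable fun z : Fin (Fintype.card (U m)) → ℝ =>
      (rank q (z ∘ Fintype.equivFin (U m)) (rvU m ω) : ℝ≥0∞) :=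
    measurable_from_top.comp ((measurable_rank q _).comp
      (measurable_pi_lambda _ fun v => measurable_pi_apply _))
  rw [lintegral_followLaw laws m ω hr, followLaw_univ, mul_right_comm]
  gcongr
  exact lintegral_wins_rank_equiv _ (fun _ => ENNReal.toReal_nonneg) (sum_toReal_eq_one _)
    hq hq1 hqu

end

/-! ### The probability of a decoding error -/

section

variable {N : ℕ} {X Y U : Fin N → Type*}
  [∀ i, Fintype (X i)] [∀ i, Fintype (Y i)] [∀ i, Fintype (U i)]
  (net : Network N X Y) {o : DecodingOrder N} (laws : NodeLaws o X Y U)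

/-- Each information-density difference becomes the selection probability divided by the decoder's
conditional probability; the factor k = j, which carries no + 1, is split off. -/
lemma boundTerm_eq (i : Fin N) (j : Fin (o.d i)) {ω : ∀ i, X i × Y i × U i}
    (hω : ideal net laws ω ≠ 0) :
    boundTerm net laws i j ω =
      auxProb laws (o.a i j) ω /
        auxCond (ideal net laws) o i j j (rvY i ω) (fun l => rvU (o.a i l) ω) (rvU (o.a i j) ω) *
      ((∏ k ∈ Finset.Ioi j, (Real.log (Fintype.card (U (o.a i k))) + 1)) *
        ∏ k ∈ Finset.Ioi j, (auxProb laws (o.a i k) ω /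
          auxCond (ideal net laws) o i j k (rvY i ω) (fun l => rvU (o.a i l) ω)
            (rvU (o.a i k) ω) + 1)) := by
  have hk : ∀ k, (2 : ℝ) ^ (-infoDensity (ideal net laws) (rvU (o.a i k))
              (fun ω' => (rvTuple o i (Finset.univ \ Finset.Icc j k) ω', rvY i ω')) ω
            + infoDensity (ideal net laws) (rvU (o.a i k))
              (fun ω' => (rvTuple o (o.a i k) (o.uniq (o.a i k)) ω', rvY (o.a i k) ω')) ω) =
      auxProb laws (o.a i k) ω /
          auxCond (ideal net laws) o i j k (rvY i ω) (fun l => rvU (o.a i l) ω)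
            (rvU (o.a i k) ω) := by
    intro k
    rw [two_rpow_infoDensity _ _ _ hω, condProb_ideal_rvU net laws _ hω]
    rfl
  rw [boundTerm, gammaFactor, ← Finset.Ioi_insert, Finset.prod_insert (by simp)]
  simp only [hk, lt_irrefl, if_false, add_zero]
  rw [mul_left_comm]
  congr 2
  exact Finset.prod_congr rfl fun k hk => by rw [if_pos (Finset.mem_Ioi.1 hk)]

lemma auxCond_pos (i : Fin N) (j k : Fin (o.d i)) {ω : ∀ i, X i × Y i × U i}
    (hω : ideal net laws ω ≠ 0) :
    0 < auxCond (ideal net laws) o i j k (rvY i ω) (fun l => rvU (o.a i l) ω)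
      (rvU (o.a i k) ω) :=
  condProb_pos (rvU (o.a i k))
    (fun ω => (rvTuple o i (Finset.univ \ Finset.Icc j k) ω, rvY i ω)) hω

lemma clockU_update (w : ∀ m, Clock X U m) (a : Fin N) (c : Clock X U a) :
    clockU (Function.update w a c) a = c.1 ∘ Fintype.equivFin (U a) := by
  simp [clockU]

/-- Given that the nodes follow the outcome `ω`, the probability of a decoding error is at most
`B_{i,j}`. -/
lemma pi_followLaw_not_decodes (i : Fin N) (j : o.uniq i) {ω : ∀ i, X i × Y i × U i}
    (hω : ideal net laws ω ≠ 0) :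
    Measure.pi (fun m => followLaw laws m ω)
        {w | ¬ Decodes net laws i (rvY i ω) w (rvTuple o i (o.uniq i) ω) j} ≤
      Measure.pi (fun m => followLaw laws m ω) Set.univ *
        ENNReal.ofReal (boundTerm net laws i j ω) := by
  set ν : ∀ m, Measure (Clock X U m) := fun m => followLaw laws m ω with hν
  set P := ideal net laws
  set t : ∀ l, U (o.a i l) := fun l => rvU (o.a i l) ω
  set y := rvY i ω
  set a : Fin N := o.a i j
  let r : ∀ k, Clock X U (o.a i k) → ℝ≥0∞ := fun k c =>
    (rank (auxCond P o i j k y t) (c.1 ∘ Fintype.equivFin (U (o.a i k))) (t k) : ℝ≥0∞)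
  have hr : ∀ k, Measurable (r k) := fun k =>
    measurable_from_top.comp ((measurable_rank _ _).comp
      (measurable_pi_lambda _ fun v => (measurable_pi_apply _).comp measurable_fst))
  let C : ℝ := auxProb laws a ω / auxCond P o i j j y t (t j) *
    ∏ k ∈ Finset.Ioi j.1, (Real.log (Fintype.card (U (o.a i k))) + 1)
  have hγ : 0 ≤ ∏ k ∈ Finset.Ioi j.1, (Real.log (Fintype.card (U (o.a i k))) + 1) :=
    Finset.prod_nonneg fun k _ => (log_card_add_one_pos (U := U) _).le
  have hC : 0 ≤ C := mul_nonneg (div_nonneg ENNReal.toReal_nonneg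
    (auxCond_nonneg _ _ _ _ _ _ _ _)) hγ
  have hE : MeasurableSet {w | ¬ Decodes net laws i y w (rvTuple o i (o.uniq i) ω) j} :=
    (measurableSet_decodes net laws i y _ j).compl
  have hm' : Measurable fun w : ∀ m, Clock X U m =>
      ∏ k ∈ Finset.Ioi j.1, r k (w (o.a i k)) :=
    Finset.measurable_fun_prod _ fun k _ => (hr k).comp (measurable_pi_apply _)
  have hm := hm'.const_mul (ENNReal.ofReal C)
  calc Measure.pi ν {w | ¬ Decodes net laws i y w (rvTuple o i (o.uniq i) ω) j}
      = ∫⁻ w, {w | ¬ Decodes net laws i y w (rvTuple o i (o.uniq i) ω) j}.indicator 1 w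
          ∂Measure.pi ν := (lintegral_indicator_one hE).symm
    _ ≤ ∫⁻ w, ENNReal.ofReal C * ∏ k ∈ Finset.Ioi j.1, r k (w (o.a i k)) ∂Measure.pi ν := by
        -- All clocks except those of the node to be decoded are frozen, which makes the decoding
        -- rates a fixed vector.
        refine lintegral_pi_le_of_update ν a (measurable_one.indicator hE) hm fun w => ?_
        have hne : ∀ k, j.1 < k → o.a i k ≠ a := fun k hk => (o.a_injective i).ne hk.ne'
        have hup : ∀ x, ∏ k ∈ Finset.Ioi j.1, r k (Function.update w a x (o.a i k)) =
            ∏ k ∈ Finset.Ioi j.1, r k (w (o.a i k)) := by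
          refine fun x => Finset.prod_congr rfl fun k hk => ?_
          rw [Function.update_of_ne (hne k (Finset.mem_Ioi.1 hk))]
        simp only [hup, lintegral_const]
        set q := decodingRate P o i j y (rvTuple o i (o.uniq i) ω) (clockU w) with hqdef
        have hq : ∀ x, decodingRate P o i j y (rvTuple o i (o.uniq i) ω)
            (clockU (Function.update w a x)) = q := by
          refine fun x => decodingRate_congr P o i y (fun _ _ => rfl) fun k hk => ?_
          simp only [clockU, Function.update_of_ne (hne k hk)]
        have hpre : (fun x => {w | ¬ Decodes net laws i y w (rvTuple o i (o.uniq i) ω) j}.indicator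
            (1 : (∀ m, Clock X U m) → ℝ≥0∞) (Function.update w a x)) =
            {c : Clock X U a | ¬ Wins q (c.1 ∘ Fintype.equivFin (U a)) (rvU a ω)}.indicator 1 := by
          funext x
          have hx : Decodes net laws i y (Function.update w a x) (rvTuple o i (o.uniq i) ω) j ↔
              Wins q (x.1 ∘ Fintype.equivFin (U a)) (rvU a ω) := by
            rw [Decodes, ← hq x, ← clockU_update w a x]
            rfl
          by_cases h : Wins q (x.1 ∘ Fintype.equivFin (U a)) (rvU a ω) <;>
            simp [Set.indicator, hx, h]
        have hB : MeasurableSet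
            {c : Clock X U a | ¬ Wins q (c.1 ∘ Fintype.equivFin (U a)) (rvU a ω)} :=
          (measurableSet_setOf_wins measurable_const (measurable_pi_lambda _ fun v =>
            (measurable_pi_apply _).comp measurable_fst) _).compl
        have hwt : 0 < tupleWeight P o i j y t (clockU w) := by
          refine mul_pos (auxCond_pos net laws i j j hω) (Finset.prod_pos fun k _ => ?_)
          exact inv_pos.2 (mul_pos (log_card_add_one_pos _) (Nat.cast_pos.2 (rank_pos _ _ _)))
        have hle : tupleWeight P o i j y t (clockU w) ≤ q (rvU a ω) :=
          tupleWeight_le_decodingRate P o i j y t (clockU w)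
        rw [hpre, lintegral_indicator_one hB]
        refine (followLaw_not_wins laws a ω (decodingRate_nonneg P o i j y _ _)
          (sum_decodingRate_le_one P o i j.2 y _ _) (hwt.trans_le hle)).trans ?_
        rw [mul_comm]
        gcongr
        have hprod : ∏ k ∈ Finset.Ioi j.1, r k (w (o.a i k)) = ENNReal.ofReal
            (∏ k ∈ Finset.Ioi j.1,
              (rank (auxCond P o i j k y t) (clockU w (o.a i k)) (t k) : ℝ)) := by
          rw [ENNReal.ofReal_prod_of_nonneg fun _ _ => Nat.cast_nonneg _]
          simp only [ENNReal.ofReal_natCast]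
          rfl
        rw [hprod, ← ENNReal.ofReal_mul hC]
        refine ENNReal.ofReal_le_ofReal ?_
        -- The weight of the true tuple replaces the full rate; inverting it brings the logarithmic
        -- factors and the ranks into the numerator.
        refine (div_le_div_of_nonneg_left ENNReal.toReal_nonneg hwt hle).trans (le_of_eq ?_)
        rw [tupleWeight, Finset.prod_inv_distrib, Finset.prod_mul_distrib]
        simp only [C]
        rw [div_mul_eq_div_div, div_inv_eq_mul, mul_assoc]
        rfl
    _ ≤ Measure.pi ν Set.univ * (ENNReal.ofReal C * ∏ k ∈ Finset.Ioi j.1,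
          ENNReal.ofReal (auxProb laws (o.a i k) ω / auxCond P o i j k y t (t k) + 1)) := by
        rw [lintegral_const_mul _ hm', mul_left_comm]
        gcongr
        refine lintegral_pi_prod_le ν (o.a_injective i) hr _ _ fun k _ => ?_
        exact lintegral_followLaw_rank laws _ ω (auxCond_nonneg _ _ _ _ _ _ _)
          (sum_auxCond_le_one _ _ _ _ _ _ _) (auxCond_pos net laws i j k hω)
    _ = _ := by
        have hf : ∀ k ∈ Finset.Ioi j.1,
            0 ≤ auxProb laws (o.a i k) ω / auxCond P o i j k y t (t k) + 1 := fun k _ =>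
          add_nonneg (div_nonneg ENNReal.toReal_nonneg (auxCond_nonneg _ _ _ _ _ _ _ _)) zero_le_one
        rw [boundTerm_eq net laws i j hω, ← ENNReal.ofReal_prod_of_nonneg hf,
          ← ENNReal.ofReal_mul hC, ← mul_assoc (_ / _)]

end

/-! ### Total variation through a common mass -/

/-- Pointwise, the part of P - Q on A is at most P - M, whose total is 1 minus the mass of M. -/
lemma prob_sub_le {α : Type*} [Fintype α] {P Q : PMF α} {M : α → ℝ≥0∞} (hP : ∀ a, M a ≤ P a)
    (hQ : ∀ a, M a ≤ Q a) {ε : ℝ} (hε : 0 ≤ ε) (h : 1 ≤ ∑ a, M a + ENNReal.ofReal ε)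
    (A : Set α) : prob P A - prob Q A ≤ ε := by
  classical
  have hM : ∀ a, M a ≠ ⊤ := fun a => ne_top_of_le_ne_top (P.apply_ne_top a) (hP a)
  have hP' : ∀ a, (M a).toReal ≤ (P a).toReal := fun a => ENNReal.toReal_mono (P.apply_ne_top a)
    (hP a)
  have hQ' : ∀ a, (M a).toReal ≤ (Q a).toReal := fun a => ENNReal.toReal_mono (Q.apply_ne_top a)
    (hQ a)
  have h' : 1 ≤ ∑ a, (M a).toReal + ε := by
    have h2 := ENNReal.toReal_mono (ENNReal.add_ne_top.2
      ⟨ENNReal.sum_ne_top.2 fun a _ => hM a, ENNReal.ofReal_ne_top⟩) h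
    rwa [ENNReal.toReal_one, ENNReal.toReal_add (ENNReal.sum_ne_top.2 fun a _ => hM a)
      ENNReal.ofReal_ne_top, ENNReal.toReal_sum fun a _ => hM a, ENNReal.toReal_ofReal hε] at h2
  calc prob P A - prob Q A
      = ∑ a, A.indicator (fun a => (P a).toReal - (Q a).toReal) a := by
        rw [prob_eq_sum, prob_eq_sum, ← Finset.sum_sub_distrib]
        exact Finset.sum_congr rfl fun a _ => by by_cases ha : a ∈ A <;> simp [ha]
    _ ≤ ∑ a, ((P a).toReal - (M a).toReal) := by
        refine Finset.sum_le_sum fun a _ => ?_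
        have h1 := hP' a
        have h2 := hQ' a
        by_cases ha : a ∈ A
        · rw [Set.indicator_of_mem ha]; linarith
        · rw [Set.indicator_of_notMem ha]; linarith
    _ ≤ ε := by
        rw [Finset.sum_sub_distrib, sum_toReal_eq_one]
        linarith

/-- Two distributions that dominate a common mass `M` have total variation distance at most the
missing mass. -/
lemma tvDist_le_of_common_mass {α : Type*} [Fintype α] {P Q : PMF α} {M : α → ℝ≥0∞}
    (hP : ∀ a, M a ≤ P a) (hQ : ∀ a, M a ≤ Q a) {ε : ℝ} (hε : 0 ≤ ε)
    (h : 1 ≤ ∑ a, M a + ENNReal.ofReal ε) : tvDist P Q ≤ ε :=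
  ciSup_le fun A => abs_sub_le_iff.2 ⟨prob_sub_le hP hQ hε h A, prob_sub_le hQ hP hε h A⟩

/-- The inputs and outputs in the outcome `ω`. -/
def projXY {N : ℕ} {X Y U : Fin N → Type*} (ω : ∀ i, X i × Y i × U i) (i : Fin N) : X i × Y i := ((ω i).1, (ω i).2.1)

/-! ### Clocks under which all nodes follow an outcome -/

section

variable {N : ℕ} {X Y U : Fin N → Type*} [∀ i, Fintype (X i)] [∀ i, Fintype (U i)]
  {o : DecodingOrder N} (laws : NodeLaws o X Y U)

/-- The clocks for which all the nodes follow the outcome `ω`. -/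
def followAll (ω : ∀ i, X i × Y i × U i) : Set (∀ m, Clock X U m) :=
  Set.univ.pi fun m => followSet laws m ω

lemma measurableSet_followAll (ω : ∀ i, X i × Y i × U i) : MeasurableSet (followAll laws ω) :=
  MeasurableSet.univ_pi fun m => measurableSet_selects laws m _ _ _ _

lemma pi_followLaw_eq (ω : ∀ i, X i × Y i × U i) :
    Measure.pi (fun m => followLaw laws m ω) =
      (Measure.pi (clockLaw X U)).restrict (followAll laws ω) :=
  (Measure.restrict_pi_pi _ _).symm

/-- The clocks and the channel outputs determine the auxiliaries node by node, by uniqueness of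
winners. Hence the outcomes over the same inputs and outputs claim disjoint sets of clocks. -/
lemma eq_of_mem_followAll {ω ω' : ∀ i, X i × Y i × U i} (hxy : projXY ω = projXY ω')
    {w : ∀ m, Clock X U m} (h : w ∈ followAll laws ω) (h' : w ∈ followAll laws ω') : ω = ω' := by
  have hx : ∀ i, (ω i).1 = (ω' i).1 := fun i => by
    have h1 := congrArg Prod.fst (congrFun hxy i)
    exact h1
  have hy : ∀ i, rvY i ω = rvY i ω' := fun i => by
    have h1 := congrArg Prod.snd (congrFun hxy i)
    exact h1
  have key : ∀ i, rvU i ω = rvU i ω' := by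
    intro i
    induction i using WellFoundedLT.induction with
    | ind i ih =>
      have h1 := (h i (Set.mem_univ i)).1
      have h2 := (h' i (Set.mem_univ i)).1
      have ht : rvTuple o i (o.uniq i) ω = rvTuple o i (o.uniq i) ω' :=
        funext fun j => ih _ (o.a_lt i j)
      rw [hy, ht] at h1
      exact h1.unique h2
  exact funext fun i => Prod.ext (hx i) (Prod.ext (hy i) (key i))

end

/-! ### Comparison of the actual and ideal distributions -/

section

variable {N : ℕ} {X Y U : Fin N → Type*}
  [∀ i, Fintype (X i)] [∀ i, Fintype (Y i)] [∀ i, Fintype (U i)]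
  (net : Network N X Y) {o : DecodingOrder N} (laws : NodeLaws o X Y U)

/-- The probability of the channel outputs along the given inputs and outputs. -/
def channelProb (xy : ∀ i, X i × Y i) : ℝ≥0∞ :=
  ∏ i, net.channel i (fun j => (xy j).1) (fun j => (xy j).2) (xy i).2

/-- The clocks for which there are no decoding errors along the outcome `ω`. -/
def decodesAll (ω : ∀ i, X i × Y i × U i) : Set (∀ m, Clock X U m) :=
  {w | ∀ i j, Decodes net laws i (rvY i ω) w (rvTuple o i (o.uniq i) ω) j}

lemma measurableSet_decodesAll (ω : ∀ i, X i × Y i × U i) :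
    MeasurableSet (decodesAll net laws ω) := by
  have : decodesAll net laws ω =
      ⋂ i, ⋂ j, {w | Decodes net laws i (rvY i ω) w (rvTuple o i (o.uniq i) ω) j} := by
    ext; simp [decodesAll]
  rw [this]
  exact MeasurableSet.iInter fun i => MeasurableSet.iInter fun j =>
    measurableSet_decodes net laws i _ _ j

/-- Races reproduce the laws P_U and P_X exactly, so only decoding errors can separate the two
distributions. -/
lemma channelProb_mul_pi_followLaw_univ (ω : ∀ i, X i × Y i × U i) :
    channelProb net (projXY ω) * Measure.pi (fun m => followLaw laws m ω) Set.univ =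
      ideal net laws ω := by
  rw [Measure.pi_univ, channelProb, ← Finset.prod_mul_distrib, ideal_apply]
  refine Finset.prod_congr rfl fun m _ => ?_
  rw [followLaw_univ, auxProb, ENNReal.ofReal_toReal (PMF.apply_ne_top _ _)]
  rfl

lemma raceScheme_f_eq [∀ i, Nonempty (X i)] {ω : ∀ i, X i × Y i × U i}
    {w : ∀ m, Clock X U m} (h : w ∈ followAll laws ω) (hd : w ∈ decodesAll net laws ω)
    (i : Fin N) : (raceScheme net laws).f i (ω i).2.1 w = (ω i).1 := by
  have hmem : (rvTuple o i (o.uniq i) ω, rvU i ω, (ω i).1) ∈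
      nodeResults net laws i (rvY i ω) w := ⟨hd i, h i (Set.mem_univ i)⟩
  have hne : (nodeResults net laws i (rvY i ω) w).Nonempty := ⟨_, hmem⟩
  have : (raceScheme net laws).f i (ω i).2.1 w = hne.some.2.2 := dif_pos hne
  rw [this, nodeResults_subsingleton net laws i _ w hne.some_mem hmem]

/-- Without decoding errors each encoder returns the input in ω, so every step has at least the
channel's probability of its output. -/
lemma channelProb_le_sequential [∀ i, Nonempty (X i)] {ω : ∀ i, X i × Y i × U i}
    {w : ∀ m, Clock X U m} (h : w ∈ followAll laws ω) (hd : w ∈ decodesAll net laws ω) :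
    channelProb net (projXY ω) ≤ sequential ((raceScheme net laws).step net w) (projXY ω) := by
  rw [sequential, PMF.ofFintype_apply, channelProb]
  refine Finset.prod_le_prod' fun i _ => ?_
  change _ ≤ (net.channel i (fun j => (projXY ω j).1) (fun j => (projXY ω j).2)).map
    (fun y => ((raceScheme net laws).f i y w, y)) (projXY ω i)
  rw [PMF.map_apply]
  refine le_trans (le_of_eq ?_) (ENNReal.le_tsum (ω i).2.1)
  have hf : projXY ω i = ((raceScheme net laws).f i (ω i).2.1 w, (ω i).2.1) :=
    Prod.ext (raceScheme_f_eq net laws h hd i).symm rfl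
  exact (if_pos hf).symm

lemma boundTerm_nonneg (i : Fin N) (j : Fin (o.d i)) (ω : ∀ i, X i × Y i × U i) :
    0 ≤ boundTerm net laws i j ω := by
  refine mul_nonneg (Finset.prod_nonneg fun k _ => (log_card_add_one_pos (U := U) _).le)
    (Finset.prod_nonneg fun k _ => add_nonneg (Real.rpow_nonneg two_pos.le _) ?_)
  split_ifs <;> norm_num

lemma pi_followLaw_decodesAll_compl {ω : ∀ i, X i × Y i × U i} (hω : ideal net laws ω ≠ 0) :
    Measure.pi (fun m => followLaw laws m ω) (decodesAll net laws ω)ᶜ ≤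
      Measure.pi (fun m => followLaw laws m ω) Set.univ *
        ENNReal.ofReal (min (∑ i, ∑ j ∈ o.uniq i, boundTerm net laws i j ω) 1) := by
  set μ := Measure.pi fun m => followLaw laws m ω
  rw [ENNReal.ofReal_min, ENNReal.ofReal_one, mul_min, mul_one]
  refine le_min ?_ (measure_mono (Set.subset_univ _))
  have hsub : (decodesAll net laws ω)ᶜ ⊆ ⋃ i ∈ (Finset.univ : Finset (Fin N)),
      ⋃ j ∈ (Finset.univ : Finset (o.uniq i)),
        {w | ¬ Decodes net laws i (rvY i ω) w (rvTuple o i (o.uniq i) ω) j} := by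
    intro w hw
    simp only [decodesAll, Set.mem_compl_iff, Set.mem_ofPred_eq, not_forall] at hw
    simpa using hw
  refine (measure_mono hsub).trans ((measure_biUnion_finset_le _ _).trans ?_)
  rw [ENNReal.ofReal_sum_of_nonneg fun i _ => Finset.sum_nonneg fun j _ =>
    boundTerm_nonneg net laws i j ω, Finset.mul_sum]
  refine Finset.sum_le_sum fun i _ => (measure_biUnion_finset_le _ _).trans ?_
  rw [ENNReal.ofReal_sum_of_nonneg fun j _ => boundTerm_nonneg net laws i j ω, Finset.mul_sum,
    ← Finset.sum_coe_sort (o.uniq i)]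
  exact Finset.sum_le_sum fun j _ => pi_followLaw_not_decodes net laws i j hω

lemma ideal_le_add (ω : ∀ i, X i × Y i × U i) :
    ideal net laws ω ≤
      channelProb net (projXY ω) *
        Measure.pi (fun m => followLaw laws m ω) (decodesAll net laws ω) +
      ENNReal.ofReal ((ideal net laws ω).toReal *
        min (∑ i, ∑ j ∈ o.uniq i, boundTerm net laws i j ω) 1) := by
  -- Null outcomes are set aside since the error bound needs positive conditional probabilities.
  by_cases hω : ideal net laws ω = 0
  · rw [hω]; exact zero_le
  rw [ENNReal.ofReal_mul ENNReal.toReal_nonneg, ENNReal.ofReal_toReal (PMF.apply_ne_top _ _)]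
  nth_rw 1 2 [← channelProb_mul_pi_followLaw_univ net laws ω]
  rw [mul_assoc, ← mul_add]
  gcongr
  refine (measure_add_measure_compl (measurableSet_decodesAll net laws ω)).symm.trans_le ?_
  gcongr
  exact pi_followLaw_decodesAll_compl net laws hω

/-- The mass on which the actual outcome coincides with an ideal outcome without errors. -/
def commonMass (xy : ∀ i, X i × Y i) : ℝ≥0∞ :=
  open Classical in ∑ ω, if xy = projXY ω then channelProb net (projXY ω) *
    Measure.pi (fun m => followLaw laws m ω) (decodesAll net laws ω) else 0

lemma commonMass_le_idealXY (xy : ∀ i, X i × Y i) :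
    commonMass net laws xy ≤ idealXY net laws xy := by
  classical
  rw [idealXY, PMF.map_apply, tsum_fintype, commonMass]
  refine Finset.sum_le_sum fun ω _ => ?_
  by_cases h : xy = projXY ω
  · rw [if_pos h, if_pos (show xy = fun i => ((ω i).1, (ω i).2.1) from h),
      ← channelProb_mul_pi_followLaw_univ net laws ω]
    gcongr
    exact Set.subset_univ _
  · rw [if_neg h]; exact zero_le

lemma commonMass_le_actual [∀ i, Nonempty (X i)] (xy : ∀ i, X i × Y i) :
    commonMass net laws xy ≤ (raceScheme net laws).actual net xy := by
  classical
  set E : (∀ i, X i × Y i × U i) → Set (∀ m, Clock X U m) := fun ω =>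
    decodesAll net laws ω ∩ followAll laws ω
  have hE : ∀ ω, MeasurableSet (E ω) := fun ω =>
    (measurableSet_decodesAll net laws ω).inter (measurableSet_followAll laws ω)
  have h1 : commonMass net laws xy = ∫⁻ w, ∑ ω, (if xy = projXY ω then
      channelProb net (projXY ω) * (E ω).indicator 1 w else 0) ∂Measure.pi (clockLaw X U) := by
    rw [lintegral_finsetSum, commonMass]
    · refine Finset.sum_congr rfl fun ω _ => ?_
      by_cases h : xy = projXY ω
      · simp only [if_pos h]
        rw [lintegral_const_mul _ (measurable_one.indicator (hE ω)),
          lintegral_indicator_one (hE ω), pi_followLaw_eq,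
          Measure.restrict_apply (measurableSet_decodesAll net laws ω)]
      · simp [if_neg h]
    · intro ω _
      by_cases h : xy = projXY ω
      · simp only [if_pos h]
        exact (measurable_one.indicator (hE ω)).const_mul _
      · simp only [if_neg h]
        exact measurable_const
  rw [h1]
  change _ ≤ ∫⁻ w, sequential ((raceScheme net laws).step net w) xy ∂Measure.pi (clockLaw X U)
  refine lintegral_mono fun w => ?_
  -- For fixed clocks at most one outcome over xy contributes, so the sum never exceeds a single
  -- channel probability.
  by_cases hex : ∃ ω, xy = projXY ω ∧ w ∈ E ω
  · obtain ⟨ω, rfl, hw⟩ := hex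
    rw [Finset.sum_eq_single ω]
    · rw [if_pos rfl, Set.indicator_of_mem hw, Pi.one_apply, mul_one]
      exact channelProb_le_sequential net laws hw.2 hw.1
    · intro ω' _ hne
      by_cases h : projXY ω = projXY ω'
      · rw [if_pos h, Set.indicator_of_notMem, mul_zero]
        exact fun hw' => hne (eq_of_mem_followAll laws h hw.2 hw'.2).symm
      · rw [if_neg h]
    · simp
  · push Not at hex
    rw [Finset.sum_eq_zero]
    · exact zero_le
    · intro ω _
      by_cases h : xy = projXY ω
      · rw [if_pos h, Set.indicator_of_notMem (hex ω h), mul_zero]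
      · rw [if_neg h]

lemma sum_commonMass : ∑ xy, commonMass net laws xy = ∑ ω, channelProb net (projXY ω) *
    Measure.pi (fun m => followLaw laws m ω) (decodesAll net laws ω) := by
  classical
  simp only [commonMass]
  rw [Finset.sum_comm]
  refine Finset.sum_congr rfl fun ω _ => ?_
  simp

lemma tvDist_raceScheme_le [∀ i, Nonempty (X i)] :
    tvDist (idealXY net laws) ((raceScheme net laws).actual net) ≤
      expectation (ideal net laws) fun ω =>
        min (∑ i, ∑ j ∈ o.uniq i, boundTerm net laws i j ω) 1 := by
  have hb : ∀ ω, 0 ≤ (ideal net laws ω).toReal *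
      min (∑ i, ∑ j ∈ o.uniq i, boundTerm net laws i j ω) 1 := fun ω =>
    mul_nonneg ENNReal.toReal_nonneg (le_min (Finset.sum_nonneg fun i _ =>
      Finset.sum_nonneg fun j _ => boundTerm_nonneg net laws i j ω) zero_le_one)
  refine tvDist_le_of_common_mass (commonMass_le_idealXY net laws) (commonMass_le_actual net laws)
    (Finset.sum_nonneg fun ω _ => hb ω) ?_
  rw [expectation, ENNReal.ofReal_sum_of_nonneg fun ω _ => hb ω, sum_commonMass,
    ← Finset.sum_add_distrib]
  calc (1 : ℝ≥0∞) = ∑ ω, ideal net laws ω := by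
        rw [← tsum_fintype (L := .unconditional _), PMF.tsum_coe]
    _ ≤ _ := Finset.sum_le_sum fun ω _ => ideal_le_add net laws ω

end

end OneShotADN

end

theorem mainTheorem1 {N : ℕ} {X Y U : Fin N → Type*}
    [∀ i, Fintype (X i)] [∀ i, Fintype (Y i)] [∀ i, Fintype (U i)]
    (net : OneShotADN.Network N X Y) (o : OneShotADN.DecodingOrder N)
    (laws : OneShotADN.NodeLaws o X Y U) :
    ∃ S : OneShotADN.PublicScheme X Y,
      OneShotADN.tvDist (OneShotADN.idealXY net laws) (S.actual net) ≤
        OneShotADN.expectation (OneShotADN.ideal net laws) (fun ω =>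
          min (∑ i, ∑ j ∈ o.uniq i, OneShotADN.boundTerm net laws i j ω) 1) := by
  have h := OneShotADN.nonempty_of_kernels (A := fun i => X i × Y i × U i)
    (OneShotADN.idealStep net laws)
  have : ∀ i, Nonempty (X i) := fun i => (h i).map Prod.fst
  exact ⟨OneShotADN.raceScheme net laws, OneShotADN.tvDist_raceScheme_le net laws⟩
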